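/- Let $N\ge 1$ be an integer, let $(\alpha_n)_{n\ge 0}$ be a scale, i.e. a sequence of positive real numbers with $\alpha_n\to\infty$, and let $\varphi\in L^2(\mathbb{R}_+)$ (complex-valued). Put $\omega_{2N-1}=\frac{2\pi^N}{(N-1)!}$ (the measure of the unit sphere of $\mathbb{R}^{2N}$), $$C_N=\frac{1}{(2\pi)^N\sqrt{\omega_{2N-1}}},\qquad \widetilde C_N=\frac{\sqrt{\omega_{2N-1}}}{(2\pi)^N},\qquad \psi(y)=\int_0^y\varphi(t)\,dt\ \ (y\ge 0),\qquad \psi(y)=0\ \ (y<0),$$ and, for $x\in\mathbb{R}^{2N}$, $$g_n(x)=\frac{C_N}{\sqrt{\alpha_n}}\int_{|\xi|\ge 1}\frac{e^{i x\cdot\xi}}{|\xi|^{2N}}\,\varphi\Big(\frac{\log|\xi|}{\alpha_n}\Big)\,d\xi ,$$ where the integral is understood in the sense of the inverse Fourier transform on $L^2(\mathbb{R}^{2N})$ (the function $\mathbf 1_{|\xi|\ge 1}|\xi|^{-2N}\varphi(\log|\xi|/\alpha_n)$ is square integrable; the integral is a Lebesgue integral for almost every $x$ if this function is also integrable). Let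 $\mathcal L=\mathcal L(\mathbb{R}^{2N})$ be the Orlicz space of the function $s\mapsto e^{s^2}-1$, i.e. the space of measurable $u:\mathbb{R}^{2N}\to\mathbb{C}$ with $\int (e^{|u(x)|^2/\lambda^2}-1)\,dx<\infty$ for some $\lambda>0$, with the norm $$\|u\|_{\mathcal L}=\inf\Big\{\lambda>0:\ \int_{\mathbb{R}^{2N}}\big(e^{|u(x)|^2/\lambda^2}-1\big)\,dx\le 1\Big\}.$$ Then $$g_n(x)=\widetilde C_N\sqrt{\alpha_n}\;\psi\Big(\frac{-\log|x|}{\alpha_n}\Big)+t_n(x),$$ where $t_n\in\mathcal L$ for every $n$ and $\|t_n\|_{\mathcal L}\to 0$ as $n\to\infty$. -/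

import Mathlib

open MeasureTheory Filter Topology Set
open scoped ENNReal FourierTransform

/-- The space `ℝ^d` with its Euclidean norm and Lebesgue measure. -/
abbrev RealSpace (d : ℕ) : Type := EuclideanSpace ℝ (Fin d)

/-- `∫ Φ(|u(x)| / c) dx`, with values in `[0, ∞]`. -/
noncomputable def orliczModular {d : ℕ} (Φ : ℝ → ℝ) (u : RealSpace d → ℂ) (c : ℝ) : ℝ≥0∞ :=
  ∫⁻ x, ENNReal.ofReal (Φ (‖u x‖ / c))

/-- Membership in the Orlicz space `L^Φ(ℝ^d)`. -/
def MemOrlicz {d : ℕ} (Φ : ℝ → ℝ) (u : RealSpace d → ℂ) : Prop :=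
  AEStronglyMeasurable u volume ∧ ∃ c : ℝ, 0 < c ∧ orliczModular Φ u c < ∞

/-- The Luxemburg norm `inf {c > 0 : ∫ Φ(|u(x)| / c) dx ≤ 1}`, with values in `[0, ∞]`
(it is `∞` when no `c` is admissible). -/
noncomputable def orliczNorm {d : ℕ} (Φ : ℝ → ℝ) (u : RealSpace d → ℂ) : ℝ≥0∞ :=
  ⨅ (c : ℝ) (_ : 0 < c) (_ : orliczModular Φ u c ≤ 1), ENNReal.ofReal c

/-- The function `s ↦ exp(s²) - 1`, which defines the Orlicz space `𝓛(ℝ^d)`. -/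
noncomputable def expSqSubOne (s : ℝ) : ℝ := Real.exp (s ^ 2) - 1

/-- A scale: a sequence of positive real numbers going to infinity. -/
structure IsScale (α : ℕ → ℝ) : Prop where
  pos : ∀ n, 0 < α n
  tendsto_atTop : Tendsto α atTop atTop

/-- A profile: (a representative of) an element of `L²(ℝ₊)`. Only the values on `(0, ∞)`
matter. -/
def IsProfile (φ : ℝ → ℂ) : Prop := MemLp φ 2 (volume.restrict (Ioi 0))

/-- `ψ(y) = ∫_0^y φ(t) dt` for `y ≥ 0`, with `ψ(y) = 0` for `y ≤ 0`
(that is, `φ` is extended by zero to the negative half-line). -/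
noncomputable def profilePrimitive (φ : ℝ → ℂ) (y : ℝ) : ℂ := ∫ t in Ioc 0 y, φ t

/-- `ω_{2N-1} = 2 π^N / (N-1)!`, the measure of the unit sphere of `ℝ^{2N}` (`N ≥ 1`). -/
noncomputable def sphereArea (N : ℕ) : ℝ := 2 * Real.pi ^ N / ((N - 1).factorial : ℝ)

/-- `C_N = 1 / ((2π)^N √ω_{2N-1})`. -/
noncomputable def concentrationConst (N : ℕ) : ℝ :=
  1 / ((2 * Real.pi) ^ N * √(sphereArea N))

/-- `C̃_N = √ω_{2N-1} / (2π)^N`. -/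
noncomputable def moserConst (N : ℕ) : ℝ := √(sphereArea N) / (2 * Real.pi) ^ N

/-- The function `1_{|ξ| ≥ 1} |ξ|^{-2N} φ(log|ξ| / a)` on `ℝ^{2N}`. -/
noncomputable def concentrationSymbol (N : ℕ) (a : ℝ) (φ : ℝ → ℂ) (ξ : RealSpace (2 * N)) : ℂ :=
  {ξ : RealSpace (2 * N) | 1 ≤ ‖ξ‖}.indicator
    (fun ξ => φ (Real.log ‖ξ‖ / a) / ((‖ξ‖ ^ (2 * N) : ℝ) : ℂ)) ξ

/-- The integral `x ↦ ∫ e^{i x·ξ} f(ξ) dξ` of a square integrable function `f`, understood as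
the `L²` (Plancherel) extension of this integral operator. Mathlib's `𝓕⁻` has the kernel
`e^{2π i y·ξ}`, hence the evaluation at `y = x / (2π)`. -/
noncomputable def plancherelIntegral {d : ℕ} {f : RealSpace d → ℂ} (hf : MemLp f 2 volume)
    (x : RealSpace d) : ℂ :=
  (𝓕⁻ (hf.toLp f) : Lp ℂ 2 (volume : Measure (RealSpace d))) ((2 * Real.pi)⁻¹ • x)

/-- For an integrable function the Plancherel integral is the Lebesgue integral. -/
theorem plancherelIntegral_ae_eq {d : ℕ} {f : RealSpace d → ℂ} (hf : MemLp f 2 volume)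
    (hi : Integrable f) :
    plancherelIntegral hf =ᵐ[volume]
      fun x => ∫ ξ, Complex.exp (Complex.I * (inner ℝ x ξ : ℝ)) * f ξ := by
  have hcont : Continuous (𝓕⁻ f) := by
    rw [Real.fourierInv_eq_fourier_comp_neg]
    exact VectorFourier.fourierIntegral_continuous Real.continuous_fourierChar
      (by simp only [innerₗ_apply_apply]; fun_prop) hi.comp_neg
  have key : ((𝓕⁻ (hf.toLp f) : Lp ℂ 2 (volume : Measure (RealSpace d))) : RealSpace d → ℂ)
      =ᵐ[volume] 𝓕⁻ f := by
    refine ae_eq_of_integral_contDiff_smul_eq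
      ((Lp.memLp _).locallyIntegrable (by norm_num)) hcont.locallyIntegrable ?_
    intro g hg hgs
    have hg1 : HasCompactSupport (Complex.ofRealCLM ∘ g) := hgs.comp_left rfl
    have hg2 : ContDiff ℝ ((⊤ : ℕ∞) : WithTop ℕ∞) (Complex.ofRealCLM ∘ g) := by fun_prop
    let G := hg1.toSchwartzMap hg2
    have e1 : ∫ x, g x • (𝓕⁻ (hf.toLp f) : Lp ℂ 2 (volume : Measure (RealSpace d))) x =
        ∫ x, (𝓕⁻ G) x • f x := by
      have := congrArg (fun T => T G) (Lp.fourierInv_toTemperedDistribution_eq (hf.toLp f))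
      simp only [TemperedDistribution.fourierInv_apply, Lp.toTemperedDistribution_apply] at this
      calc _ = ∫ x, G x • (𝓕⁻ (hf.toLp f) : Lp ℂ 2 (volume : Measure (RealSpace d))) x := by
            simp [G]
        _ = ∫ x, (𝓕⁻ G) x • (hf.toLp f) x := this.symm
        _ = _ := integral_congr_ae (by
            filter_upwards [hf.coeFn_toLp] with x hx
            rw [hx])
    rw [e1]
    have e2 : ∫ x, (𝓕⁻ (G : RealSpace d → ℂ)) x • f x = ∫ x, G x • (𝓕⁻ f) x := by
      have := VectorFourier.integral_fourierIntegral_smul_eq_flip (L := -innerₗ (RealSpace d))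
        (e := Real.fourierChar) (μ := volume) (ν := volume) Real.continuous_fourierChar
        (by simp only [LinearMap.neg_apply, innerₗ_apply_apply]; fun_prop) G.integrable hi
      simpa [VectorFourier.fourierIntegral, Real.fourierInv_eq, real_inner_comm] using this
    rw [SchwartzMap.fourierInv_coe, e2]
    simp [G]
  have hne : (2 * Real.pi)⁻¹ ≠ 0 := by positivity
  have hq : Measure.QuasiMeasurePreserving (fun x : RealSpace d => (2 * Real.pi)⁻¹ • x)
      volume volume := by
    refine ⟨measurable_const_smul _, ?_⟩
    rw [Measure.map_addHaar_smul _ hne]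
    exact Measure.smul_absolutelyContinuous
  refine (hq.ae_eq_comp key).trans (Eventually.of_forall fun x => ?_)
  simp only [Function.comp_apply, Real.fourierInv_eq']
  refine integral_congr_ae (Eventually.of_forall fun ξ => ?_)
  simp only [real_inner_smul_right, smul_eq_mul, real_inner_comm]
  congr 2
  push_cast
  have : (Real.pi : ℂ) ≠ 0 := by exact_mod_cast Real.pi_ne_zero
  field_simp

/-- Integrability on `(1, ∞)` in exponential coordinates. -/
theorem integrableOn_exp_iff {a : ℝ} (ha : 0 < a) (f : ℝ → ℂ) :
    IntegrableOn f (Ioi 1) ↔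
      IntegrableOn (fun t => ((a * Real.exp (a * t) : ℝ) : ℂ) * f (Real.exp (a * t))) (Ioi 0) := by
  have himg : (fun t => Real.exp (a * t)) '' Ioi 0 = Ioi 1 := by
    ext y
    constructor
    · rintro ⟨t, ht, rfl⟩
      exact Real.one_lt_exp_iff.2 (mul_pos ha ht)
    · intro hy
      have hy' : (1 : ℝ) < y := hy
      refine ⟨Real.log y / a, div_pos (Real.log_pos hy') ha, ?_⟩
      have : a * (Real.log y / a) = Real.log y := by field_simp
      simp only [this]
      exact Real.exp_log (by linarith)
  have hderiv : ∀ t ∈ Ioi (0 : ℝ),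
      HasDerivWithinAt (fun t => Real.exp (a * t)) (a * Real.exp (a * t)) (Ioi 0) t := by
    intro t _
    have := ((hasDerivAt_id t).const_mul a).exp
    simp only [id, mul_one] at this
    rw [mul_comm]
    exact this.hasDerivWithinAt
  have hinj : InjOn (fun t => Real.exp (a * t)) (Ioi 0) := by
    intro s _ t _ h
    exact mul_left_cancel₀ ha.ne' (Real.exp_injective h)
  rw [← himg, integrableOn_image_iff_integrableOn_abs_deriv_smul measurableSet_Ioi hderiv hinj]
  refine integrableOn_congr_fun (fun t _ => ?_) measurableSet_Ioi
  simp only [abs_of_pos (mul_pos ha (Real.exp_pos _)), Complex.real_smul]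

/-- A radial function supported in `|ξ| ≥ 1` is integrable on `ℝ^{2N}` iff its profile is, in
logarithmic coordinates. -/
theorem integrable_radial_iff {N : ℕ} (hN : 1 ≤ N) {a : ℝ} (ha : 0 < a) (f : ℝ → ℂ) :
    Integrable (fun ξ : RealSpace (2 * N) => (Ici (1 : ℝ)).indicator f ‖ξ‖) ↔
      IntegrableOn (fun t => ((a * Real.exp (a * t) * Real.exp (a * t) ^ (2 * N - 1) : ℝ) : ℂ)
        * f (Real.exp (a * t))) (Ioi 0) := by
  have : Nontrivial (RealSpace (2 * N)) := by
    have : Nonempty (Fin (2 * N)) := ⟨⟨0, by omega⟩⟩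
    infer_instance
  rw [integrable_fun_norm_addHaar (volume : Measure (RealSpace (2 * N)))
    (f := (Ici (1 : ℝ)).indicator f)]
  have h1 : (fun y : ℝ => y ^ (Module.finrank ℝ (RealSpace (2 * N)) - 1) •
      (Ici (1 : ℝ)).indicator f y) =
      (Ici (1 : ℝ)).indicator (fun y => ((y ^ (2 * N - 1) : ℝ) : ℂ) * f y) := by
    funext y
    by_cases hy : y ∈ Ici (1 : ℝ) <;> simp [hy]
  have h2 : Ici (1 : ℝ) ∩ Ioi 0 = Ici 1 :=
    inter_eq_left.2 fun y (hy : (1 : ℝ) ≤ y) => lt_of_lt_of_le one_pos hy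
  rw [h1, integrableOn_indicator_iff measurableSet_Ici, h2, integrableOn_Ici_iff_integrableOn_Ioi,
    integrableOn_exp_iff ha]
  refine integrableOn_congr_fun (fun t _ => ?_) measurableSet_Ioi
  push_cast
  ring

/-- The symbol of an elementary concentration is square integrable. -/
theorem memLp_concentrationSymbol {N : ℕ} (hN : 1 ≤ N) {a : ℝ} (ha : 0 < a) {φ : ℝ → ℂ}
    (hφ : IsProfile φ) : MemLp (concentrationSymbol N a φ) 2 volume := by
  have hr : ∀ t : ℝ, a * Real.exp (a * t) * Real.exp (a * t) ^ (2 * N - 1) =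
      a * Real.exp (a * t) ^ (2 * N) := fun t => by
    rw [mul_assoc, ← pow_succ', Nat.sub_add_cancel (by omega)]
  have hlog : ∀ t : ℝ, Real.log (Real.exp (a * t)) / a = t := fun t => by
    rw [Real.log_exp]; field_simp
  have hw : ∀ t : ℝ, a * Real.exp (a * t) ^ (2 * N) / Real.exp (a * t) ^ (4 * N) =
      a * Real.exp (-(2 * N * a) * t) := fun t => by
    rw [mul_div_assoc, ← Real.exp_nat_mul, ← Real.exp_nat_mul, ← Real.exp_sub]
    congr 2
    push_cast
    ring
  have hpos : (0 : ℝ) < 2 * N * a := by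
    have : (0 : ℝ) < N := by exact_mod_cast hN
    positivity
  have hexp : MemLp (fun t : ℝ => ((a * Real.exp (-(2 * N * a) * t) : ℝ) : ℂ)) 2
      (volume.restrict (Ioi 0)) := by
    refine MemLp.ofReal ((memLp_two_iff_integrable_sq ?_).2 ?_)
    · exact (by fun_prop : Continuous fun t : ℝ =>
        a * Real.exp (-(2 * N * a) * t)).aestronglyMeasurable
    · have h := (exp_neg_integrableOn_Ioi 0 (b := 2 * (2 * N * a)) (by positivity)).const_mul (a ^ 2)
      refine h.congr (Eventually.of_forall fun t => ?_)
      have h2 : Real.exp (-(2 * N * a) * t) ^ 2 = Real.exp (-(2 * (2 * N * a)) * t) := by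
        rw [← Real.exp_nat_mul]
        congr 1
        push_cast
        ring
      exact ((mul_pow _ _ 2).trans (by rw [h2])).symm
  have hmeas : AEStronglyMeasurable (concentrationSymbol N a φ) volume := by
    have hint : Integrable (fun ξ : RealSpace (2 * N) => (Ici (1 : ℝ)).indicator
        (fun r => φ (Real.log r / a) / ((r ^ (4 * N) : ℝ) : ℂ)) ‖ξ‖) := by
      rw [integrable_radial_iff hN ha]
      refine (hexp.integrable_mul hφ).congr (Eventually.of_forall fun t => ?_)
      simp only [Pi.mul_apply, hr, hlog, ← hw]
      push_cast
      ring
    have hcont : Continuous fun ξ : RealSpace (2 * N) => ((‖ξ‖ ^ (2 * N) : ℝ) : ℂ) := by fun_prop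
    refine (hint.aestronglyMeasurable.mul hcont.aestronglyMeasurable).congr
      (Eventually.of_forall fun ξ => ?_)
    by_cases hξ : 1 ≤ ‖ξ‖
    · have h0 : ((‖ξ‖ : ℝ) : ℂ) ≠ 0 := by
        exact_mod_cast (lt_of_lt_of_le one_pos hξ).ne'
      simp only [Pi.mul_apply, concentrationSymbol, indicator, mem_Ici, mem_ofPred_eq, hξ, if_true]
      push_cast
      rw [show 4 * N = 2 * N + 2 * N by ring, pow_add]
      field_simp
    · simp [concentrationSymbol, indicator, hξ]
  rw [memLp_two_iff_integrable_sq_norm hmeas]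
  have hint : Integrable (fun ξ : RealSpace (2 * N) => (Ici (1 : ℝ)).indicator
      (fun r => (((‖φ (Real.log r / a)‖ ^ 2) / r ^ (4 * N) : ℝ) : ℂ)) ‖ξ‖) := by
    rw [integrable_radial_iff hN ha]
    have h2 : Integrable (fun t => ‖φ t‖ ^ 2) (volume.restrict (Ioi 0)) :=
      (memLp_two_iff_integrable_sq_norm hφ.1).1 hφ
    have h3 : Integrable (fun t => (a * Real.exp (-(2 * N * a) * t)) * ‖φ t‖ ^ 2)
        (volume.restrict (Ioi 0)) := by
      refine h2.bdd_mul (c := a) ?_ ?_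
      · exact (by fun_prop : Continuous fun t : ℝ =>
          a * Real.exp (-(2 * N * a) * t)).aestronglyMeasurable
      · filter_upwards [ae_restrict_mem measurableSet_Ioi] with t ht
        have ht' : (0 : ℝ) < t := ht
        rw [Real.norm_of_nonneg (by positivity)]
        refine mul_le_of_le_one_right ha.le (Real.exp_le_one_iff.2 ?_)
        nlinarith
    refine h3.ofReal.congr (Eventually.of_forall fun t => ?_)
    have h4 : a * Real.exp (-(2 * N * a) * t) * ‖φ t‖ ^ 2 =
        a * Real.exp (a * t) ^ (2 * N) * (‖φ t‖ ^ 2 / Real.exp (a * t) ^ (4 * N)) := by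
      rw [← hw]; ring
    simp only [hr, hlog, ← Complex.ofReal_mul]
    exact congrArg _ h4
  refine hint.re.congr (Eventually.of_forall fun ξ => ?_)
  by_cases hξ : 1 ≤ ‖ξ‖
  · simp only [concentrationSymbol, indicator, mem_Ici, mem_ofPred_eq, hξ, if_true,
      norm_div, Complex.norm_real, norm_pow, norm_norm, div_pow]
    rw [← pow_mul, show 2 * N * 2 = 4 * N by ring]
    simp only [RCLike.re_to_complex, Complex.ofReal_re]
  · simp [concentrationSymbol, indicator, hξ]

/-- The elementary concentration
`(C_N / √a) ∫_{|ξ| ≥ 1} e^{i x·ξ} |ξ|^{-2N} φ(log|ξ| / a) dξ`. -/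
noncomputable def elementaryConcentration {N : ℕ} (hN : 1 ≤ N) {a : ℝ} (ha : 0 < a) {φ : ℝ → ℂ}
    (hφ : IsProfile φ) (x : RealSpace (2 * N)) : ℂ :=
  ((concentrationConst N / √a : ℝ) : ℂ) *
    plancherelIntegral (memLp_concentrationSymbol hN ha hφ) x

/-- The generalized Moser example `C̃_N √a ψ(-log|x| / a)`. -/
noncomputable def moserConcentration (N : ℕ) (a : ℝ) (φ : ℝ → ℂ) (x : RealSpace (2 * N)) : ℂ :=
  ((moserConst N * √a : ℝ) : ℂ) * profilePrimitive φ (-Real.log ‖x‖ / a)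

/-!
Write `t_a(φ)` for the difference between the elementary concentration `g_a(φ)` and the Moser
function `m_a(φ)(x) = C̃_N √a ψ(-log|x| / a)`. Both depend linearly on `φ`, so the proof is a
density argument: a bound of `t_a` by the `L²` norm of the profile, uniform in `a`, and
convergence to zero for smooth compactly supported profiles.

*Uniform bound* (`exists_orliczModular_sub_le`). For `m_a(φ)`, Cauchy-Schwarz gives
`|ψ(y)| ≤ √y ‖φ‖₂`, and `|x|⁻¹` is integrable on the unit ball of `ℝ^{2N}`. For `g_a(φ)`, cut the frequencies
at `|ξ| = e^k`. In the variable `t = log|ξ| / a` the measure `|ξ|^{-2N} dξ` is a multiple of `dt`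
(`map_log_norm_dilationMeasure`), so the low frequencies are bounded by `C̃_N √k ‖φ‖₂` and the
high ones have `L²` norm at most `e^{-Nk} ‖φ‖₂`, for every `a`. Where `|g_a(φ)|` is about
`2 C̃_N √k ‖φ‖₂`, at least half of it comes from the high frequencies, so `exp(s²) - 1`, with `s` the
ratio `|g_a(φ)| / (2 C̃_N ‖φ‖₂)`, is dominated by a series of squares of the high frequency parts
with weights `e^{k+1}`, whose integrals form a convergent geometric series.

*Smooth profiles* (`tendsto_orliczModular_of_smooth`). Cut the frequencies at `R ∼ 1 / |x|`. Below
`R` the phase `e^{i x·ξ}` can be replaced by `1` up to a bounded error, and the integral of the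
symbol over `|ξ| ≤ R` is a primitive of `φ` (`norm_integral_low_sub_le`). Above `R`, translating
by half a wavelength changes the sign of the phase, so the integral is bounded by an `L¹` modulus
of continuity of the symbol, which is scale invariant (`norm_integral_high_le`). The factor
`1 / √a` in front of the integral then makes `t_a(φ)` of size `O(1 / √a)` uniformly in `x`.
Plancherel's identity outside the unit ball gives the same rate in `L²`, and the two together
control the Luxemburg norm.
-/

/-! ### The Luxemburg norm of `exp(s²) - 1` -/

theorem expSqSubOne_nonneg (s : ℝ) : 0 ≤ expSqSubOne s := by
  have := Real.add_one_le_exp (s ^ 2)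
  unfold expSqSubOne
  nlinarith [sq_nonneg s]

theorem expSqSubOne_mono {s t : ℝ} (hs : 0 ≤ s) (h : s ≤ t) : expSqSubOne s ≤ expSqSubOne t := by
  unfold expSqSubOne
  gcongr

theorem continuous_expSqSubOne : Continuous expSqSubOne := by
  unfold expSqSubOne
  fun_prop

theorem convexOn_expSqSubOne : ConvexOn ℝ univ expSqSubOne := by
  have h1 : ConvexOn ℝ univ fun s : ℝ => s ^ 2 := even_two.convexOn_pow
  have h2 : ConvexOn ℝ univ fun s : ℝ => Real.exp (s ^ 2) := by
    refine ⟨convex_univ, fun x _ y _ a b ha hb hab => ?_⟩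
    refine (Real.exp_le_exp.2 (h1.2 (mem_univ x) (mem_univ y) ha hb hab)).trans ?_
    exact convexOn_exp.2 (mem_univ _) (mem_univ _) ha hb hab
  exact h2.sub (concaveOn_const 1 convex_univ)

theorem expSqSubOne_le_sq_mul_exp (s : ℝ) : expSqSubOne s ≤ s ^ 2 * Real.exp (s ^ 2) := by
  have h := Real.add_one_le_exp (-s ^ 2)
  have h2 : Real.exp (-s ^ 2) * Real.exp (s ^ 2) = 1 := by
    rw [← Real.exp_add]; simp
  unfold expSqSubOne
  nlinarith [Real.exp_pos (s ^ 2)]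

theorem expSqSubOne_div_le {K : ℝ} (hK : 1 ≤ K) (s : ℝ) :
    expSqSubOne (s / K) ≤ expSqSubOne s / K := by
  have hK0 : 0 < K := by linarith
  have h := convexOn_expSqSubOne.2 (mem_univ s) (mem_univ 0)
    (by positivity : 0 ≤ 1 / K) (sub_nonneg.2 ((div_le_one hK0).2 hK)) (by ring)
  have h0 : expSqSubOne 0 = 0 := by simp [expSqSubOne]
  simp only [smul_eq_mul, mul_zero, add_zero, h0] at h
  rwa [one_div_mul_eq_div, one_div_mul_eq_div] at h

section Orlicz

variable {d : ℕ}

theorem orliczModular_congr_ae {u v : RealSpace d → ℂ} (h : u =ᵐ[volume] v) (Φ : ℝ → ℝ) (c : ℝ) :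
    orliczModular Φ u c = orliczModular Φ v c := by
  refine lintegral_congr_ae ?_
  filter_upwards [h] with x hx
  rw [hx]

theorem orliczModular_neg (Φ : ℝ → ℝ) (u : RealSpace d → ℂ) (c : ℝ) :
    orliczModular Φ (-u) c = orliczModular Φ u c := by
  simp [orliczModular]

/-- The triangle inequality for the Luxemburg norm, from convexity of `exp(s²) - 1`. -/
theorem orliczModular_add_le_one {u v : RealSpace d → ℂ} (hu : AEStronglyMeasurable u volume)
    {b c : ℝ} (hb : 0 < b) (hc : 0 < c) (h1 : orliczModular expSqSubOne u b ≤ 1)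
    (h2 : orliczModular expSqSubOne v c ≤ 1) : orliczModular expSqSubOne (u + v) (b + c) ≤ 1 := by
  have hbc : 0 < b + c := by linarith
  have key : ∀ x, ENNReal.ofReal (expSqSubOne (‖(u + v) x‖ / (b + c))) ≤
      ENNReal.ofReal (b / (b + c)) * ENNReal.ofReal (expSqSubOne (‖u x‖ / b)) +
      ENNReal.ofReal (c / (b + c)) * ENNReal.ofReal (expSqSubOne (‖v x‖ / c)) := by
    intro x
    rw [← ENNReal.ofReal_mul (by positivity), ← ENNReal.ofReal_mul (by positivity),
      ← ENNReal.ofReal_add (mul_nonneg (by positivity) (expSqSubOne_nonneg _))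
        (mul_nonneg (by positivity) (expSqSubOne_nonneg _))]
    refine ENNReal.ofReal_le_ofReal ?_
    have h := convexOn_expSqSubOne.2 (mem_univ (‖u x‖ / b)) (mem_univ (‖v x‖ / c))
      (by positivity : 0 ≤ b / (b + c)) (by positivity : 0 ≤ c / (b + c)) (by field_simp)
    refine le_trans (expSqSubOne_mono (by positivity) ?_) h
    have h3 : b / (b + c) * (‖u x‖ / b) + c / (b + c) * (‖v x‖ / c) =
        (‖u x‖ + ‖v x‖) / (b + c) := by field_simp
    simp only [smul_eq_mul, h3, Pi.add_apply]
    gcongr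
    exact norm_add_le _ _
  have hm : AEMeasurable (fun x => ENNReal.ofReal (b / (b + c)) *
      ENNReal.ofReal (expSqSubOne (‖u x‖ / b))) volume := by
    have := continuous_expSqSubOne.measurable
    have := hu.norm.aemeasurable
    fun_prop
  calc orliczModular expSqSubOne (u + v) (b + c)
      ≤ ENNReal.ofReal (b / (b + c)) * orliczModular expSqSubOne u b +
        ENNReal.ofReal (c / (b + c)) * orliczModular expSqSubOne v c := by
        refine (lintegral_mono key).trans ?_
        rw [lintegral_add_left' hm, lintegral_const_mul' _ _ ENNReal.ofReal_ne_top,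
          lintegral_const_mul' _ _ ENNReal.ofReal_ne_top]
        rfl
    _ ≤ ENNReal.ofReal (b / (b + c)) * 1 + ENNReal.ofReal (c / (b + c)) * 1 := by gcongr
    _ = 1 := by
        rw [mul_one, mul_one, ← ENNReal.ofReal_add (by positivity) (by positivity),
          ← ENNReal.ofReal_one]
        congr 1
        field_simp

/-- A finite bound on the modular becomes the bound `1` after enlarging the scale. -/
theorem orliczModular_mul_le_one {u : RealSpace d → ℂ} {c K : ℝ} (hK : 1 ≤ K)
    (h : orliczModular expSqSubOne u c ≤ ENNReal.ofReal K) :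
    orliczModular expSqSubOne u (K * c) ≤ 1 := by
  have hK0 : 0 < K := by linarith
  calc orliczModular expSqSubOne u (K * c)
      ≤ ∫⁻ x, ENNReal.ofReal K⁻¹ * ENNReal.ofReal (expSqSubOne (‖u x‖ / c)) := by
        refine lintegral_mono fun x => ?_
        rw [← ENNReal.ofReal_mul (by positivity)]
        refine ENNReal.ofReal_le_ofReal ?_
        rw [mul_comm K c, ← div_div, mul_comm, ← div_eq_mul_inv]
        exact expSqSubOne_div_le hK _
    _ = ENNReal.ofReal K⁻¹ * orliczModular expSqSubOne u c :=
        lintegral_const_mul' _ _ ENNReal.ofReal_ne_top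
    _ ≤ ENNReal.ofReal K⁻¹ * ENNReal.ofReal K := by gcongr
    _ = 1 := by
        rw [← ENNReal.ofReal_mul (by positivity), inv_mul_cancel₀ hK0.ne', ENNReal.ofReal_one]

theorem orliczNorm_le {Φ : ℝ → ℝ} {u : RealSpace d → ℂ} {c : ℝ} (hc : 0 < c)
    (h : orliczModular Φ u c ≤ 1) : orliczNorm Φ u ≤ ENNReal.ofReal c :=
  iInf_le_of_le c (iInf_le_of_le hc (iInf_le_of_le h le_rfl))

/-- The modular of a bounded square integrable function. -/
theorem orliczModular_le_of_bounded {u : RealSpace d → ℂ} {b c : ℝ} (hc : 0 < c)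
    (h : ∀ᵐ x, ‖u x‖ ≤ b) :
    orliczModular expSqSubOne u c ≤
      ENNReal.ofReal (Real.exp ((b / c) ^ 2) / c ^ 2) * ∫⁻ x, ‖u x‖ₑ ^ 2 := by
  rw [← lintegral_const_mul' _ _ ENNReal.ofReal_ne_top]
  refine lintegral_mono_ae ?_
  filter_upwards [h] with x hx
  rw [← ofReal_norm, ← ENNReal.ofReal_pow (norm_nonneg _), ← ENNReal.ofReal_mul (by positivity)]
  refine ENNReal.ofReal_le_ofReal ((expSqSubOne_le_sq_mul_exp _).trans ?_)
  have : Real.exp ((‖u x‖ / c) ^ 2) ≤ Real.exp ((b / c) ^ 2) := by gcongr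
  calc (‖u x‖ / c) ^ 2 * Real.exp ((‖u x‖ / c) ^ 2)
      ≤ (‖u x‖ / c) ^ 2 * Real.exp ((b / c) ^ 2) := by gcongr
    _ = _ := by rw [div_pow]; ring

end Orlicz

/-! ### Polar coordinates on a logarithmic scale -/

theorem sphereArea_pos (N : ℕ) : 0 < sphereArea N := by
  unfold sphereArea
  positivity

theorem toSphere_univ_eq_sphereArea {N : ℕ} (hN : 1 ≤ N) :
    (volume : Measure (RealSpace (2 * N))).toSphere univ = ENNReal.ofReal (sphereArea N) := by
  have : Nonempty (Fin (2 * N)) := ⟨⟨0, by omega⟩⟩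
  rw [Measure.toSphere_apply_univ, EuclideanSpace.volume_ball]
  obtain ⟨M, rfl⟩ : ∃ M, N = M + 1 := ⟨N - 1, by omega⟩
  have h1 : (((Fintype.card (Fin (2 * (M + 1)))) : ℝ) / 2 + 1) = ((M + 1 : ℕ) : ℝ) + 1 := by
    simp
  have h2 : √Real.pi ^ (Fintype.card (Fin (2 * (M + 1)))) = Real.pi ^ (M + 1) := by
    rw [Fintype.card_fin, pow_mul, Real.sq_sqrt Real.pi_pos.le]
  rw [h1, Real.Gamma_nat_eq_factorial, h2, ENNReal.ofReal_one, one_pow, one_mul,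
    finrank_euclideanSpace_fin, ← ENNReal.ofReal_natCast, ← ENNReal.ofReal_mul (by positivity)]
  congr 1
  unfold sphereArea
  rw [Nat.add_sub_cancel, Nat.factorial_succ]
  push_cast
  have : (M.factorial : ℝ) ≠ 0 := by positivity
  field_simp

theorem lintegral_fun_norm_eq {N : ℕ} (hN : 1 ≤ N) {f : ℝ → ℝ≥0∞} (hf : Measurable f) :
    ∫⁻ ξ : RealSpace (2 * N), f ‖ξ‖ =
      ENNReal.ofReal (sphereArea N) *
        ∫⁻ r in Ioi (0 : ℝ), ENNReal.ofReal (r ^ (2 * N - 1)) * f r := by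
  have : Nonempty (Fin (2 * N)) := ⟨⟨0, by omega⟩⟩
  set μ : Measure (RealSpace (2 * N)) := volume
  calc ∫⁻ ξ, f ‖ξ‖ ∂μ = ∫⁻ ξ : ({(0)}ᶜ : Set (RealSpace (2 * N))), f ‖ξ.1‖ ∂(μ.comap (↑)) := by
        rw [lintegral_subtype_comap (measurableSet_singleton _).compl fun x => f ‖x‖,
          restrict_compl_singleton]
    _ = ∫⁻ x, f x.2 ∂μ.toSphere.prod
          (.volumeIoiPow (Module.finrank ℝ (RealSpace (2 * N)) - 1)) := by
        simpa using μ.measurePreserving_homeomorphUnitSphereProd.lintegral_comp_emb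
          (Homeomorph.measurableEmbedding _) (f ∘ Subtype.val ∘ Prod.snd)
    _ = _ := by
        rw [lintegral_prod _ (by fun_prop)]
        simp only [lintegral_const, toSphere_univ_eq_sphereArea hN, μ]
        rw [mul_comm, finrank_euclideanSpace_fin, Measure.volumeIoiPow,
          lintegral_withDensity_eq_lintegral_mul _ (by fun_prop) (by fun_prop)]
        congr 1
        exact lintegral_subtype_comap measurableSet_Ioi
          fun r => ENNReal.ofReal (r ^ (2 * N - 1)) * f r

/-- The measure `1_{|ξ| ≥ 1} |ξ|^{-2N} dξ`, which is invariant under dilations up to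
truncation. -/
noncomputable def dilationMeasure (N : ℕ) : Measure (RealSpace (2 * N)) :=
  (volume.restrict {ξ | 1 ≤ ‖ξ‖}).withDensity fun ξ => ENNReal.ofReal (‖ξ‖ ^ (2 * N))⁻¹

theorem measurableSet_one_le_norm (d : ℕ) : MeasurableSet {ξ : RealSpace d | 1 ≤ ‖ξ‖} :=
  measurableSet_le measurable_const measurable_norm

theorem lintegral_dilationMeasure (N : ℕ) (f : RealSpace (2 * N) → ℝ≥0∞) :
    ∫⁻ ξ, f ξ ∂dilationMeasure N =
      ∫⁻ ξ in {ξ | 1 ≤ ‖ξ‖}, ENNReal.ofReal (‖ξ‖ ^ (2 * N))⁻¹ * f ξ := by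
  rw [dilationMeasure, lintegral_withDensity_eq_lintegral_mul_non_measurable _ (by fun_prop)
    (Eventually.of_forall fun _ => ENNReal.ofReal_lt_top)]
  rfl

theorem lintegral_Ici_one_log {a : ℝ} (ha : 0 < a) (f : ℝ → ℝ≥0∞) :
    ∫⁻ r in Ici (1 : ℝ), ENNReal.ofReal r⁻¹ * f (Real.log r / a) =
      ENNReal.ofReal a * ∫⁻ t in Ioi (0 : ℝ), f t := by
  have himg : (fun t => Real.exp (a * t)) '' Ioi 0 = Ioi 1 := by
    ext y
    constructor
    · rintro ⟨t, ht, rfl⟩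
      exact Real.one_lt_exp_iff.2 (mul_pos ha ht)
    · intro hy
      have hy' : (1 : ℝ) < y := hy
      refine ⟨Real.log y / a, div_pos (Real.log_pos hy') ha, ?_⟩
      have : a * (Real.log y / a) = Real.log y := by field_simp
      simp only [this]
      exact Real.exp_log (by linarith)
  have hderiv : ∀ t ∈ Ioi (0 : ℝ),
      HasDerivWithinAt (fun t => Real.exp (a * t)) (a * Real.exp (a * t)) (Ioi 0) t := by
    intro t _
    have := ((hasDerivAt_id t).const_mul a).exp
    simp only [id, mul_one] at this
    rw [mul_comm]
    exact this.hasDerivWithinAt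
  have hinj : InjOn (fun t => Real.exp (a * t)) (Ioi 0) := by
    intro s _ t _ h
    exact mul_left_cancel₀ ha.ne' (Real.exp_injective h)
  rw [← setLIntegral_congr Ioi_ae_eq_Ici, ← himg,
    lintegral_image_eq_lintegral_abs_deriv_mul measurableSet_Ioi hderiv hinj,
    ← lintegral_const_mul' _ _ ENNReal.ofReal_ne_top]
  refine lintegral_congr fun t => ?_
  have h1 : Real.log (Real.exp (a * t)) / a = t := by
    rw [Real.log_exp]; field_simp
  rw [h1, ← mul_assoc, ← ENNReal.ofReal_mul (abs_nonneg _),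
    abs_of_pos (mul_pos ha (Real.exp_pos _)), mul_assoc,
    mul_inv_cancel₀ (Real.exp_pos _).ne', mul_one]

/-- In the variable `t = log|ξ| / a` the measure `1_{|ξ| ≥ 1} |ξ|^{-2N} dξ` is a multiple of
Lebesgue measure on `(0, ∞)`; this is why `φ` is only evaluated at `log|ξ| / a`. -/
theorem map_log_norm_dilationMeasure {N : ℕ} (hN : 1 ≤ N) {a : ℝ} (ha : 0 < a) :
    (dilationMeasure N).map (fun ξ => Real.log ‖ξ‖ / a) =
      ENNReal.ofReal (sphereArea N * a) • volume.restrict (Ioi 0) := by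
  refine Measure.ext_of_lintegral _ fun f hf => ?_
  have hm : Measurable fun ξ : RealSpace (2 * N) => Real.log ‖ξ‖ / a := by fun_prop
  rw [lintegral_map hf hm, lintegral_dilationMeasure, lintegral_smul_measure,
    ← lintegral_indicator (measurableSet_one_le_norm _)]
  have h1 : Measurable ((Ici (1 : ℝ)).indicator fun r =>
      ENNReal.ofReal (r ^ (2 * N))⁻¹ * f (Real.log r / a)) :=
    Measurable.indicator (by fun_prop) measurableSet_Ici
  calc _ = ∫⁻ ξ : RealSpace (2 * N), (Ici (1 : ℝ)).indicator (fun r =>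
          ENNReal.ofReal (r ^ (2 * N))⁻¹ * f (Real.log r / a)) ‖ξ‖ := rfl
    _ = ENNReal.ofReal (sphereArea N) * ∫⁻ r in Ici (1 : ℝ),
          ENNReal.ofReal r⁻¹ * f (Real.log r / a) := by
        rw [lintegral_fun_norm_eq hN h1]
        congr 1
        rw [← lintegral_indicator measurableSet_Ici, ← lintegral_indicator measurableSet_Ioi]
        refine lintegral_congr fun r => ?_
        by_cases hr : 1 ≤ r
        · have hr0 : 0 < r := by linarith
          simp only [indicator, mem_Ioi, hr0, mem_Ici, hr, if_true]
          rw [← mul_assoc, ← ENNReal.ofReal_mul (by positivity)]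
          congr 2
          rw [← div_eq_mul_inv, div_eq_iff (by positivity), inv_mul_eq_div,
            eq_div_iff hr0.ne', ← pow_succ, Nat.sub_add_cancel (by omega)]
        · simp [indicator, hr]
    _ = _ := by
        rw [lintegral_Ici_one_log ha, ← mul_assoc, ← ENNReal.ofReal_mul (sphereArea_pos N).le]
        rfl

/-! ### The Plancherel integral -/

section Plancherel

variable {d : ℕ} {f g : RealSpace d → ℂ}

theorem quasiMeasurePreserving_inv_two_pi_smul (d : ℕ) :
    Measure.QuasiMeasurePreserving (fun x : RealSpace d => (2 * Real.pi)⁻¹ • x)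
      volume volume := by
  refine ⟨measurable_const_smul _, ?_⟩
  rw [Measure.map_addHaar_smul _ (by positivity)]
  exact Measure.smul_absolutelyContinuous

theorem aestronglyMeasurable_plancherelIntegral (hf : MemLp f 2 volume) :
    AEStronglyMeasurable (plancherelIntegral hf) volume :=
  (Lp.aestronglyMeasurable _).comp_quasiMeasurePreserving
    (quasiMeasurePreserving_inv_two_pi_smul d)

theorem plancherelIntegral_add (hf : MemLp f 2 volume) (hg : MemLp g 2 volume) :
    plancherelIntegral (hf.add hg) =ᵐ[volume] plancherelIntegral hf + plancherelIntegral hg := by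
  have h := Lp.coeFn_add (𝓕⁻ (hf.toLp f) : Lp ℂ 2 (volume : Measure (RealSpace d)))
    (𝓕⁻ (hg.toLp g))
  have he : (𝓕⁻ ((hf.add hg).toLp (f + g)) : Lp ℂ 2 (volume : Measure (RealSpace d))) =
      𝓕⁻ (hf.toLp f) + 𝓕⁻ (hg.toLp g) := by
    rw [MemLp.toLp_add hf hg, FourierTransform.fourierInv_add]
  rw [← he] at h
  exact (quasiMeasurePreserving_inv_two_pi_smul d).ae_eq_comp h

theorem plancherelIntegral_congr (hf : MemLp f 2 volume) (hg : MemLp g 2 volume)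
    (h : f =ᵐ[volume] g) : plancherelIntegral hf = plancherelIntegral hg := by
  unfold plancherelIntegral
  rw [MemLp.toLp_congr hf hg h]

theorem lintegral_enorm_sq_eq_eLpNorm_sq {α : Type*} [MeasurableSpace α] (μ : Measure α)
    (f : α → ℂ) : ∫⁻ x, ‖f x‖ₑ ^ 2 ∂μ = eLpNorm f 2 μ ^ 2 := by
  rw [eLpNorm_eq_lintegral_rpow_enorm_toReal (by norm_num) (by norm_num)]
  simp only [ENNReal.toReal_ofNat, ENNReal.rpow_ofNat]
  rw [← ENNReal.rpow_natCast, ← ENNReal.rpow_mul]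
  norm_num

/-- Plancherel's identity in the normalization without `2π` in the exponent. -/
theorem lintegral_enorm_sq_plancherelIntegral (hf : MemLp f 2 volume) :
    ∫⁻ x, ‖plancherelIntegral hf x‖ₑ ^ 2 =
      ENNReal.ofReal ((2 * Real.pi) ^ d) * ∫⁻ ξ, ‖f ξ‖ₑ ^ 2 := by
  set G : Lp ℂ 2 (volume : Measure (RealSpace d)) := 𝓕⁻ (hf.toLp f) with hG
  have hpi : (2 * Real.pi)⁻¹ ≠ 0 := by positivity
  have h1 : ∫⁻ x, ‖plancherelIntegral hf x‖ₑ ^ 2 =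
      ∫⁻ y, ‖G y‖ₑ ^ 2 ∂(volume.map fun x : RealSpace d => (2 * Real.pi)⁻¹ • x) := by
    exact ((Homeomorph.smulOfNeZero _ hpi).measurableEmbedding.lintegral_map
      (fun y => ‖G y‖ₑ ^ 2)).symm
  have h2 : ‖G‖ = ‖hf.toLp f‖ := by
    have := Lp.norm_fourier_eq G
    rw [hG, FourierTransform.fourier_fourierInv_eq] at this
    exact this.symm
  have h3 : eLpNorm G 2 volume = eLpNorm f 2 volume := by
    rw [Lp.norm_def, Lp.norm_def, eLpNorm_congr_ae hf.coeFn_toLp,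
      ENNReal.toReal_eq_toReal_iff' (Lp.eLpNorm_ne_top _) hf.2.ne] at h2
    exact h2
  rw [h1, Measure.map_addHaar_smul _ hpi, lintegral_smul_measure,
    lintegral_enorm_sq_eq_eLpNorm_sq, lintegral_enorm_sq_eq_eLpNorm_sq, h3, smul_eq_mul]
  congr 2
  rw [finrank_euclideanSpace_fin, inv_pow, inv_inv, abs_of_pos (by positivity)]

theorem ae_enorm_plancherelIntegral_le (hf : MemLp f 2 volume) (hi : Integrable f) :
    ∀ᵐ x, ‖plancherelIntegral hf x‖ₑ ≤ ∫⁻ ξ, ‖f ξ‖ₑ := by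
  filter_upwards [plancherelIntegral_ae_eq hf hi] with x hx
  rw [hx]
  refine (enorm_integral_le_lintegral_enorm _).trans (lintegral_mono fun ξ => ?_)
  rw [enorm_mul, ← ofReal_norm (Complex.exp _), mul_comm Complex.I, Complex.norm_exp_ofReal_mul_I]
  simp

end Plancherel

/-! ### Uniform bounds in terms of the `L²` norm of the profile -/

theorem moserConst_pos (N : ℕ) : 0 < moserConst N := by
  have := sphereArea_pos N
  unfold moserConst
  positivity

theorem concentrationConst_pos (N : ℕ) : 0 < concentrationConst N := by
  have := sphereArea_pos N
  unfold concentrationConst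
  positivity

theorem concentrationConst_mul_sphereArea (N : ℕ) :
    concentrationConst N * sphereArea N = moserConst N := by
  have h := sphereArea_pos N
  have h2 := Real.mul_self_sqrt h.le
  have h3 : √(sphereArea N) ≠ 0 := (Real.sqrt_pos.2 h).ne'
  unfold concentrationConst moserConst
  nth_rewrite 2 [← h2]
  field_simp

theorem concentrationConst_sq (N : ℕ) :
    concentrationConst N ^ 2 * ((2 * Real.pi) ^ (2 * N) * sphereArea N) = 1 := by
  have h := sphereArea_pos N
  unfold concentrationConst
  rw [div_pow, mul_pow, Real.sq_sqrt h.le, ← pow_mul, mul_comm N 2]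
  field_simp

/-- The Cauchy-Schwarz inequality on `(0, T]`. -/
theorem lintegral_enorm_Ioc_le {φ : ℝ → ℂ} (hφ : IsProfile φ) (T : ℝ) :
    ∫⁻ t in Ioc 0 T, ‖φ t‖ₑ ≤
      ENNReal.ofReal (√T) * eLpNorm φ 2 (volume.restrict (Ioi 0)) := by
  have hle : volume.restrict (Ioc 0 T) ≤ volume.restrict (Ioi (0 : ℝ)) :=
    Measure.restrict_mono Ioc_subset_Ioi_self le_rfl
  have h := eLpNorm_le_eLpNorm_mul_rpow_measure_univ (p := 1) (q := 2) (by norm_num)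
    (hφ.1.mono_measure hle)
  rw [eLpNorm_one_eq_lintegral_enorm] at h
  refine h.trans ?_
  rw [mul_comm]
  have h2 : (volume.restrict (Ioc 0 T)) univ ^ (1 / (1 : ℝ≥0∞).toReal - 1 / (2 : ℝ≥0∞).toReal) =
      ENNReal.ofReal (√T) := by
    rw [Measure.restrict_apply_univ, Real.volume_Ioc, sub_zero]
    rcases le_total 0 T with hT | hT
    · rw [ENNReal.ofReal_rpow_of_nonneg hT (by norm_num), Real.sqrt_eq_rpow]
      norm_num
    · rw [ENNReal.ofReal_of_nonpos hT, Real.sqrt_eq_zero_of_nonpos hT, ENNReal.ofReal_zero]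
      norm_num
  rw [h2]
  gcongr

theorem lintegral_log_norm_dilationMeasure {N : ℕ} (hN : 1 ≤ N) {a : ℝ} (ha : 0 < a)
    {h : ℝ → ℝ≥0∞} (hh : AEMeasurable h (volume.restrict (Ioi 0))) :
    ∫⁻ ξ, h (Real.log ‖ξ‖ / a) ∂dilationMeasure N =
      ENNReal.ofReal (sphereArea N * a) * ∫⁻ t in Ioi (0 : ℝ), h t := by
  have hm : Measurable fun ξ : RealSpace (2 * N) => Real.log ‖ξ‖ / a := by fun_prop
  have hmap := map_log_norm_dilationMeasure hN ha
  rw [← lintegral_map' (f := h) (by rw [hmap]; exact hh.smul_measure _) hm.aemeasurable, hmap,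
    lintegral_smul_measure, smul_eq_mul]

/-- The low frequency part of a symbol in `L¹`. -/
theorem lintegral_low_concentrationSymbol {N : ℕ} (hN : 1 ≤ N) {a : ℝ} (ha : 0 < a) {φ : ℝ → ℂ}
    (hφ : IsProfile φ) {R : ℝ} (hR : 0 < R) :
    ∫⁻ ξ, ‖{ξ | ‖ξ‖ ≤ R}.indicator (concentrationSymbol N a φ) ξ‖ₑ =
      ENNReal.ofReal (sphereArea N * a) * ∫⁻ t in Ioc 0 (Real.log R / a), ‖φ t‖ₑ := by
  have h1 := lintegral_log_norm_dilationMeasure hN ha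
    (h := (Iic (Real.log R / a)).indicator fun t => ‖φ t‖ₑ)
    (hφ.1.enorm.indicator measurableSet_Iic)
  rw [lintegral_indicator measurableSet_Iic, Measure.restrict_restrict measurableSet_Iic,
    inter_comm, Ioi_inter_Iic] at h1
  rw [← h1, lintegral_dilationMeasure, ← lintegral_indicator (measurableSet_one_le_norm _)]
  refine lintegral_congr fun ξ => ?_
  by_cases h : 1 ≤ ‖ξ‖
  · have h0 : 0 < ‖ξ‖ := by linarith
    have hiff : Real.log ‖ξ‖ / a ≤ Real.log R / a ↔ ‖ξ‖ ≤ R := by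
      rw [div_le_div_iff_of_pos_right ha, Real.log_le_log_iff h0 hR]
    by_cases h2 : ‖ξ‖ ≤ R
    · simp only [indicator, mem_ofPred_eq, h, h2, if_true, concentrationSymbol, mem_Iic, hiff]
      rw [← ofReal_norm, norm_div, div_eq_inv_mul, ENNReal.ofReal_mul (by positivity), ofReal_norm,
        Complex.norm_real, norm_pow, norm_norm]
    · simp [indicator, h2, hiff]
  · simp [indicator, h, concentrationSymbol]

/-- The high frequency part of a symbol in `L²`. -/
theorem lintegral_high_concentrationSymbol_le {N : ℕ} (hN : 1 ≤ N) {a : ℝ} (ha : 0 < a)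
    {φ : ℝ → ℂ} (hφ : IsProfile φ) {R : ℝ} (hR : 0 < R) :
    ∫⁻ ξ, ‖{ξ | R < ‖ξ‖}.indicator (concentrationSymbol N a φ) ξ‖ₑ ^ 2 ≤
      ENNReal.ofReal ((R ^ (2 * N))⁻¹ * (sphereArea N * a)) *
        eLpNorm φ 2 (volume.restrict (Ioi 0)) ^ 2 := by
  have h1 := lintegral_log_norm_dilationMeasure hN ha
    (h := fun t => ‖φ t‖ₑ ^ 2) (hφ.1.enorm.pow_const 2)
  rw [ENNReal.ofReal_mul (by positivity), mul_assoc, ← lintegral_enorm_sq_eq_eLpNorm_sq, ← h1,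
    lintegral_dilationMeasure, ← lintegral_indicator (measurableSet_one_le_norm _),
    ← lintegral_const_mul' _ _ ENNReal.ofReal_ne_top]
  refine lintegral_mono fun ξ => ?_
  by_cases h : 1 ≤ ‖ξ‖
  · have h0 : 0 < ‖ξ‖ := by linarith
    by_cases h2 : R < ‖ξ‖
    · simp only [indicator, mem_ofPred_eq, h, h2, if_true, concentrationSymbol]
      rw [← ofReal_norm, ← ofReal_norm, ← ENNReal.ofReal_pow (norm_nonneg _),
        ← ENNReal.ofReal_pow (norm_nonneg _), ← ENNReal.ofReal_mul (by positivity),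
        ← ENNReal.ofReal_mul (by positivity)]
      refine ENNReal.ofReal_le_ofReal ?_
      rw [norm_div, Complex.norm_real, norm_pow, norm_norm, div_pow, div_eq_inv_mul,
        ← mul_assoc, sq (‖ξ‖ ^ (2 * N)), mul_inv]
      gcongr
    · simp [indicator, h2]
  · simp [indicator, h, concentrationSymbol]

/-- A Moser-Trudinger type bound: the elementary concentrations are bounded in the Orlicz space by
the `L²` norm of the profile, uniformly in the scale. -/
theorem exists_orliczModular_elementaryConcentration_le {N : ℕ} (hN : 1 ≤ N) :
    ∃ K : ℝ, 0 < K ∧ ∀ {a : ℝ} (ha : 0 < a) {φ : ℝ → ℂ} (hφ : IsProfile φ) {A : ℝ}, 0 < A →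
      eLpNorm φ 2 (volume.restrict (Ioi 0)) ≤ ENNReal.ofReal A →
      orliczModular expSqSubOne (elementaryConcentration hN ha hφ) (K * A) ≤ 1 := by
  set m := moserConst N with hm_def
  have hm : 0 < m := moserConst_pos N
  have hgeom : Summable fun k : ℕ => Real.exp 1 / m ^ 2 * Real.exp (-1) ^ k :=
    (summable_geometric_of_lt_one (Real.exp_pos _).le
      (Real.exp_lt_one_iff.2 (by norm_num))).mul_left _
  set B := ∑' k : ℕ, Real.exp 1 / m ^ 2 * Real.exp (-1) ^ k with hB
  refine ⟨(max 1 B) * (2 * m), by positivity, fun {a} ha {φ} hφ {A} hA hφA => ?_⟩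
  rw [mul_assoc]
  refine orliczModular_mul_le_one (le_max_left _ _) ?_
  refine le_trans ?_ (ENNReal.ofReal_le_ofReal (le_max_right _ _))
  set κ := concentrationConst N / √a with hκ
  have hsqa : 0 < √a := Real.sqrt_pos.2 ha
  have hκ0 : 0 < κ := div_pos (concentrationConst_pos N) hsqa
  have hs := memLp_concentrationSymbol hN ha hφ
  have hlow (k : ℕ) : MemLp ({ξ | ‖ξ‖ ≤ Real.exp k}.indicator (concentrationSymbol N a φ)) 2
      volume := hs.indicator (measurableSet_le measurable_norm measurable_const)
  have hhigh (k : ℕ) : MemLp ({ξ | Real.exp k < ‖ξ‖}.indicator (concentrationSymbol N a φ)) 2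
      volume := hs.indicator (measurableSet_lt measurable_const measurable_norm)
  set g := elementaryConcentration hN ha hφ with hg
  let H : ℕ → RealSpace (2 * N) → ℂ := fun k x => (κ : ℂ) * plancherelIntegral (hhigh k) x
  have hHm (k : ℕ) : AEMeasurable (fun x => ‖H k x‖ₑ ^ 2) volume :=
    ((aestronglyMeasurable_plancherelIntegral (hhigh k)).const_mul _).enorm.pow_const 2
  have hsplit : ∀ k : ℕ, ∀ᵐ x, ‖g x - H k x‖ ≤ m * √k * A := by
    intro k
    have hL1 := lintegral_low_concentrationSymbol hN ha hφ (Real.exp_pos k)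
    have hCS := lintegral_enorm_Ioc_le hφ (Real.log (Real.exp k) / a)
    rw [Real.log_exp] at hL1 hCS
    have hL : ∫⁻ ξ, ‖{ξ | ‖ξ‖ ≤ Real.exp k}.indicator (concentrationSymbol N a φ) ξ‖ₑ ≤
        ENNReal.ofReal (sphereArea N * a * (√(k / a) * A)) := by
      rw [hL1, ENNReal.ofReal_mul (mul_pos (sphereArea_pos N) ha).le,
        ENNReal.ofReal_mul (Real.sqrt_nonneg _)]
      gcongr
      exact hCS.trans (by gcongr)
    have hi : Integrable ({ξ | ‖ξ‖ ≤ Real.exp k}.indicator (concentrationSymbol N a φ)) :=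
      ⟨(hlow k).1, lt_of_le_of_lt hL ENNReal.ofReal_lt_top⟩
    have hsum : concentrationSymbol N a φ =
        {ξ | ‖ξ‖ ≤ Real.exp k}.indicator (concentrationSymbol N a φ) +
        {ξ | Real.exp k < ‖ξ‖}.indicator (concentrationSymbol N a φ) := by
      have : {ξ : RealSpace (2 * N) | Real.exp k < ‖ξ‖} = {ξ | ‖ξ‖ ≤ Real.exp k}ᶜ := by
        ext ξ; simp
      rw [this, indicator_self_add_compl]
    have hadd := plancherelIntegral_add (hlow k) (hhigh k)
    rw [← plancherelIntegral_congr hs _ (Eventually.of_forall (congrFun hsum))] at hadd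
    filter_upwards [hadd, ae_enorm_plancherelIntegral_le (hlow k) hi] with x hx1 hx2
    have h3 := hx2.trans hL
    rw [← ofReal_norm, ENNReal.ofReal_le_ofReal_iff
      (by have := sphereArea_pos N; positivity)] at h3
    have h4 : g x - H k x = (κ : ℂ) * plancherelIntegral (hlow k) x := by
      simp only [hg, elementaryConcentration, hx1, H, hκ, Pi.add_apply]
      ring
    rw [h4, norm_mul, Complex.norm_real, Real.norm_of_nonneg hκ0.le]
    refine (mul_le_mul_of_nonneg_left h3 hκ0.le).trans (le_of_eq ?_)
    rw [hκ, hm_def, ← concentrationConst_mul_sphereArea, Real.sqrt_div (by positivity)]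
    field_simp
    rw [Real.sq_sqrt ha.le]
    ring
  have hHint : ∀ k : ℕ, ∫⁻ x, ‖H k x‖ₑ ^ 2 ≤
      ENNReal.ofReal ((Real.exp k ^ (2 * N))⁻¹ * A ^ 2) := by
    intro k
    have h1 := lintegral_high_concentrationSymbol_le hN ha hφ (Real.exp_pos k)
    have h2 : ∀ x, ‖H k x‖ₑ ^ 2 =
        ENNReal.ofReal (κ ^ 2) * ‖plancherelIntegral (hhigh k) x‖ₑ ^ 2 := by
      intro x
      rw [enorm_mul, mul_pow, ← ofReal_norm (κ : ℂ), Complex.norm_real,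
        Real.norm_of_nonneg hκ0.le, ENNReal.ofReal_pow hκ0.le]
    simp_rw [h2]
    rw [lintegral_const_mul' _ _ ENNReal.ofReal_ne_top, lintegral_enorm_sq_plancherelIntegral]
    calc _ ≤ ENNReal.ofReal (κ ^ 2) * (ENNReal.ofReal ((2 * Real.pi) ^ (2 * N)) *
          (ENNReal.ofReal ((Real.exp k ^ (2 * N))⁻¹ * (sphereArea N * a)) *
            ENNReal.ofReal A ^ 2)) := by
          gcongr
          exact h1.trans (by gcongr)
      _ = ENNReal.ofReal (κ ^ 2 * ((2 * Real.pi) ^ (2 * N) *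
          ((Real.exp k ^ (2 * N))⁻¹ * (sphereArea N * a) * A ^ 2))) := by
          have := sphereArea_pos N
          rw [← ENNReal.ofReal_pow hA.le, ← ENNReal.ofReal_mul (by positivity),
            ← ENNReal.ofReal_mul (by positivity), ← ENNReal.ofReal_mul (by positivity)]
      _ = _ := by
          congr 1
          rw [hκ, div_pow, Real.sq_sqrt ha.le, ← mul_one ((Real.exp k ^ (2 * N))⁻¹ * A ^ 2),
            ← concentrationConst_sq N]
          field_simp
  have hpt : ∀ᵐ x, ENNReal.ofReal (expSqSubOne (‖g x‖ / (2 * m * A))) ≤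
      ∑' k : ℕ, ENNReal.ofReal (Real.exp (k + 1) / (m * A) ^ 2) * ‖H k x‖ₑ ^ 2 := by
    filter_upwards [ae_all_iff.2 hsplit] with x hx
    set s := ‖g x‖ / (2 * m * A) with hs_def
    have hs0 : 0 ≤ s := by positivity
    -- The frequency cut is adapted to the height: the frequencies below `exp ⌊s²⌋` account for at
    -- most half of `‖g x‖`, so the higher ones carry the rest.
    set k := ⌊s ^ 2⌋₊
    have hk1 : (k : ℝ) ≤ s ^ 2 := Nat.floor_le (sq_nonneg s)
    have hk2 : s ^ 2 ≤ k + 1 := (Nat.lt_floor_add_one _).le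
    have hk3 : √k ≤ s := Real.sqrt_le_iff.2 ⟨hs0, hk1⟩
    have hgs : ‖g x‖ = 2 * m * A * s := by rw [hs_def]; field_simp
    have hH : m * A * s ≤ ‖H k x‖ := by
      have h1 := hx k
      have h2 := norm_sub_norm_le (g x) (H k x)
      have h3 : m * √k * A ≤ m * s * A := by gcongr
      nlinarith
    refine le_trans ?_ (ENNReal.le_tsum k)
    rw [← ofReal_norm, ← ENNReal.ofReal_pow (norm_nonneg _), ← ENNReal.ofReal_mul (by positivity)]
    refine ENNReal.ofReal_le_ofReal ((expSqSubOne_le_sq_mul_exp s).trans ?_)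
    calc s ^ 2 * Real.exp (s ^ 2) ≤ s ^ 2 * Real.exp (k + 1) := by gcongr
      _ = Real.exp (k + 1) / (m * A) ^ 2 * (m * A * s) ^ 2 := by field_simp
      _ ≤ _ := by gcongr
  calc orliczModular expSqSubOne g (2 * m * A)
      ≤ ∫⁻ x, ∑' k : ℕ, ENNReal.ofReal (Real.exp (k + 1) / (m * A) ^ 2) * ‖H k x‖ₑ ^ 2 :=
        lintegral_mono_ae hpt
    _ = ∑' k : ℕ, ENNReal.ofReal (Real.exp (k + 1) / (m * A) ^ 2) * ∫⁻ x, ‖H k x‖ₑ ^ 2 := by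
        rw [lintegral_tsum fun k => (hHm k).const_mul _]
        simp_rw [lintegral_const_mul' _ _ ENNReal.ofReal_ne_top]
    _ ≤ ∑' k : ℕ, ENNReal.ofReal (Real.exp 1 / m ^ 2 * Real.exp (-1) ^ k) := by
        refine ENNReal.tsum_le_tsum fun k => ?_
        refine (mul_le_mul_right (hHint k) _).trans ?_
        rw [← ENNReal.ofReal_mul (by positivity)]
        refine ENNReal.ofReal_le_ofReal ?_
        have h1 : Real.exp (k + 1) * (Real.exp k ^ (2 * N))⁻¹ ≤
            Real.exp 1 * Real.exp (-1) ^ k := by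
          rw [← Real.exp_nat_mul, ← Real.exp_nat_mul, ← Real.exp_neg, ← Real.exp_add,
            ← Real.exp_add]
          refine Real.exp_le_exp.2 ?_
          have hN' : (1 : ℝ) ≤ N := by exact_mod_cast hN
          have hk : (0 : ℝ) ≤ k := by positivity
          push_cast
          nlinarith
        calc _ = Real.exp (k + 1) * (Real.exp k ^ (2 * N))⁻¹ / m ^ 2 := by field_simp
          _ ≤ Real.exp 1 * Real.exp (-1) ^ k / m ^ 2 := by gcongr
          _ = _ := by ring
    _ = ENNReal.ofReal B := by
        rw [hB, ENNReal.ofReal_tsum_of_nonneg (fun k => by positivity) hgeom]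

theorem IsProfile.integrableOn_Ioc {φ : ℝ → ℂ} (hφ : IsProfile φ) (T : ℝ) :
    IntegrableOn φ (Ioc 0 T) := by
  have h : MemLp φ 2 (volume.restrict (Ioc 0 T)) :=
    hφ.mono_measure (Measure.restrict_mono Ioc_subset_Ioi_self le_rfl)
  exact h.integrable (by norm_num)

theorem norm_profilePrimitive_le {φ : ℝ → ℂ} (hφ : IsProfile φ) {A : ℝ} (hA : 0 ≤ A)
    (hφA : eLpNorm φ 2 (volume.restrict (Ioi 0)) ≤ ENNReal.ofReal A) (y : ℝ) :
    ‖profilePrimitive φ y‖ ≤ √y * A := by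
  have h := (enorm_integral_le_lintegral_enorm _).trans (lintegral_enorm_Ioc_le hφ y)
  rw [← ENNReal.ofReal_le_ofReal_iff (by positivity), ofReal_norm,
    ENNReal.ofReal_mul (Real.sqrt_nonneg _)]
  exact h.trans (by gcongr)

theorem profilePrimitive_eq_intervalIntegral (φ : ℝ → ℂ) (y : ℝ) :
    profilePrimitive φ y = ∫ t in (0 : ℝ)..(max y 0), φ t := by
  rw [intervalIntegral.integral_of_le (le_max_right _ _), profilePrimitive]
  rcases le_total y 0 with h | h
  · rw [max_eq_right h, Ioc_eq_empty (not_lt.2 h), Ioc_self]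
  · rw [max_eq_left h]

theorem continuous_profilePrimitive {φ : ℝ → ℂ} (hφ : IsProfile φ) :
    Continuous (profilePrimitive φ) := by
  -- The zero extension of the profile is locally integrable on the whole line.
  have h2 : ∀ y, profilePrimitive φ y = ∫ t in (0 : ℝ)..(max y 0), (Ioi 0).indicator φ t := by
    intro y
    rw [profilePrimitive_eq_intervalIntegral, intervalIntegral.integral_of_le (le_max_right _ _),
      intervalIntegral.integral_of_le (le_max_right _ _)]
    exact setIntegral_congr_fun measurableSet_Ioc fun t ht => by
      simp [indicator, mem_Ioi.2 ht.1]
  have h3 : ∀ b c : ℝ, IntervalIntegrable ((Ioi 0).indicator φ) volume b c := by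
    intro b c
    rw [intervalIntegrable_iff, integrableOn_indicator_iff measurableSet_Ioi]
    refine (hφ.integrableOn_Ioc (max b c)).mono_set ?_
    rintro t ⟨ht1, ht2⟩
    exact ⟨ht1, (uIoc_subset_uIcc ht2).2⟩
  have h4 := intervalIntegral.continuous_primitive h3 0
  rw [funext h2]
  exact h4.comp (continuous_id.max continuous_const)

theorem aestronglyMeasurable_moserConcentration (N : ℕ) (a : ℝ) {φ : ℝ → ℂ} (hφ : IsProfile φ) :
    AEStronglyMeasurable (moserConcentration N a φ) volume := by
  have h1 : Measurable fun x : RealSpace (2 * N) => -Real.log ‖x‖ / a := by fun_prop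
  exact (((continuous_profilePrimitive hφ).measurable.comp h1).const_mul _).aestronglyMeasurable

theorem aestronglyMeasurable_elementaryConcentration {N : ℕ} (hN : 1 ≤ N) {a : ℝ} (ha : 0 < a)
    {φ : ℝ → ℂ} (hφ : IsProfile φ) :
    AEStronglyMeasurable (elementaryConcentration hN ha hφ) volume :=
  (aestronglyMeasurable_plancherelIntegral _).const_mul _

theorem lintegral_ball_inv_norm_le {N : ℕ} (hN : 1 ≤ N) :
    ∫⁻ x : RealSpace (2 * N), (Iio (1 : ℝ)).indicator (fun r => ENNReal.ofReal r⁻¹) ‖x‖ ≤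
      ENNReal.ofReal (sphereArea N) := by
  rw [lintegral_fun_norm_eq hN (Measurable.indicator (by fun_prop) measurableSet_Iio)]
  refine (mul_le_mul_right (?_ : _ ≤ (1 : ℝ≥0∞)) _).trans (mul_one _).le
  calc _ ≤ ∫⁻ r in Ioi (0 : ℝ), (Iio (1 : ℝ)).indicator 1 r := by
        refine setLIntegral_mono (measurable_one.indicator measurableSet_Iio) fun r hr => ?_
        have hr0 : 0 < r := hr
        by_cases h : r < 1
        · simp only [indicator, mem_Iio, h, if_true, Pi.one_apply]
          rw [← ENNReal.ofReal_mul (by positivity), ← ENNReal.ofReal_one]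
          refine ENNReal.ofReal_le_ofReal ?_
          rw [← div_eq_mul_inv, div_le_one hr0]
          exact pow_le_of_le_one hr0.le h.le (by omega)
        · simp [indicator, h]
    _ = 1 := by
        rw [lintegral_indicator_one measurableSet_Iio,
          Measure.restrict_apply measurableSet_Iio, inter_comm, Ioi_inter_Iio]
        simp

/-- The Moser functions are bounded in the Orlicz space by the `L²` norm of the profile, uniformly
in the scale: the square of the function is at most a multiple of `-log|x|`. -/
theorem exists_orliczModular_moserConcentration_le {N : ℕ} (hN : 1 ≤ N) :
    ∃ K : ℝ, 0 < K ∧ ∀ {a : ℝ}, 0 < a → ∀ {φ : ℝ → ℂ}, IsProfile φ → ∀ {A : ℝ}, 0 < A →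
      eLpNorm φ 2 (volume.restrict (Ioi 0)) ≤ ENNReal.ofReal A →
      orliczModular expSqSubOne (moserConcentration N a φ) (K * A) ≤ 1 := by
  set m := moserConst N with hm_def
  have hm : 0 < m := moserConst_pos N
  refine ⟨(max 1 (sphereArea N)) * m, by positivity, fun {a} ha {φ} hφ {A} hA hφA => ?_⟩
  rw [mul_assoc]
  refine orliczModular_mul_le_one (le_max_left _ _) ?_
  refine le_trans ?_ (ENNReal.ofReal_le_ofReal (le_max_right _ _))
  refine le_trans (lintegral_mono fun x => ?_) (lintegral_ball_inv_norm_le hN)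
  have h1 : ‖moserConcentration N a φ x‖ / (m * A) ≤ √(-Real.log ‖x‖) := by
    rw [moserConcentration, norm_mul, Complex.norm_real, Real.norm_of_nonneg (by positivity),
      ← hm_def, div_le_iff₀ (by positivity)]
    calc _ ≤ m * √a * (√(-Real.log ‖x‖ / a) * A) := by
          gcongr
          exact norm_profilePrimitive_le hφ hA.le hφA _
      _ = _ := by
          have : 0 < √a := Real.sqrt_pos.2 ha
          rw [Real.sqrt_div' _ ha.le]
          field_simp
  have h2 := expSqSubOne_mono (by positivity) h1
  by_cases hx : 0 < ‖x‖ ∧ ‖x‖ < 1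
  · simp only [indicator, mem_Iio, hx.2, if_true]
    refine ENNReal.ofReal_le_ofReal (h2.trans ?_)
    have h3 : 0 ≤ -Real.log ‖x‖ := by
      have := Real.log_neg hx.1 hx.2
      linarith
    rw [expSqSubOne, Real.sq_sqrt h3, Real.exp_neg, Real.exp_log hx.1]
    linarith
  · have h3 : -Real.log ‖x‖ ≤ 0 := by
      rcases (norm_nonneg x).eq_or_lt' with h | h
      · simp [h]
      · have := Real.log_nonneg (not_lt.1 fun h' => hx ⟨h, h'⟩)
        linarith
    rw [Real.sqrt_eq_zero_of_nonpos h3] at h2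
    rw [ENNReal.ofReal_of_nonpos (h2.trans (by simp [expSqSubOne]))]
    exact zero_le

/-! ### Smooth profiles: the high frequencies -/

/-- Oscillation turns a translation by half a wavelength into a change of sign, so an oscillatory
integral is controlled by an `L¹` modulus of continuity of its amplitude. -/
theorem norm_integral_exp_inner_mul_le {d : ℕ} {F : RealSpace d → ℂ} (hF : Integrable F)
    {x h : RealSpace d} (hxh : inner ℝ x h = Real.pi) :
    ‖∫ ξ, Complex.exp (Complex.I * (inner ℝ x ξ : ℝ)) * F ξ‖ ≤ ∫ ξ, ‖F ξ - F (ξ - h)‖ := by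
  set e : RealSpace d → ℂ := fun ξ => Complex.exp (Complex.I * (inner ℝ x ξ : ℝ)) with he
  have hnorm : ∀ ξ, ‖e ξ‖ = 1 := fun ξ => by
    simp only [he]
    rw [mul_comm, Complex.norm_exp_ofReal_mul_I]
  have hcont : Continuous e := by fun_prop
  have hbd : ∀ {G : RealSpace d → ℂ}, Integrable G → Integrable fun ξ => e ξ * G ξ :=
    fun hG => hG.bdd_mul (c := 1) hcont.aestronglyMeasurable
      (Eventually.of_forall fun ξ => (hnorm ξ).le)
  have hF' : Integrable fun ξ => F (ξ - h) := hF.comp_sub_right h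
  have h1 : ∫ ξ, e ξ * F (ξ - h) = -∫ ξ, e ξ * F ξ := by
    rw [← integral_neg, ← integral_sub_right_eq_self (fun ξ => -(e ξ * F ξ)) h]
    refine integral_congr_ae (Eventually.of_forall fun ξ => ?_)
    have h2 : e ξ = -e (ξ - h) := by
      have h3 : Complex.I * (inner ℝ x ξ : ℝ) =
          Complex.I * (inner ℝ x (ξ - h) : ℝ) + Real.pi * Complex.I := by
        rw [inner_sub_right, hxh]
        push_cast
        ring
      simp only [he]
      rw [h3, Complex.exp_add, Complex.exp_pi_mul_I]
      ring
    simp only [h2]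
    ring
  have h2 : ∫ ξ, e ξ * (F ξ - F (ξ - h)) = 2 * ∫ ξ, e ξ * F ξ := by
    simp_rw [mul_sub]
    rw [integral_sub (hbd hF) (hbd hF'), h1]
    ring
  have h3 : ‖∫ ξ, e ξ * (F ξ - F (ξ - h))‖ ≤ ∫ ξ, ‖F ξ - F (ξ - h)‖ := by
    refine (norm_integral_le_integral_norm _).trans (le_of_eq ?_)
    refine integral_congr_ae (Eventually.of_forall fun ξ => ?_)
    simp only [norm_mul, hnorm, one_mul]
  rw [h2, norm_mul, Complex.norm_ofNat] at h3
  linarith [norm_nonneg (∫ ξ, e ξ * F ξ)]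

/-- The mean value inequality for `u ↦ φ(log u / a) / u ^ n`, whose derivative is of size
`u ^ (-n - 1)` uniformly in `a ≥ 1`. -/
theorem norm_radialAmplitude_sub_le {φ : ℝ → ℂ} {M : ℝ} (hd : Differentiable ℝ φ)
    (h0 : ∀ t, ‖φ t‖ ≤ M) (h1 : ∀ t, ‖deriv φ t‖ ≤ M) {a : ℝ} (ha : 1 ≤ a) (n : ℕ) {ρ r s : ℝ}
    (hρ : 0 < ρ) (hr : ρ ≤ r) (hs : ρ ≤ s) :
    ‖φ (Real.log r / a) / ((r ^ n : ℝ) : ℂ) - φ (Real.log s / a) / ((s ^ n : ℝ) : ℂ)‖ ≤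
      M * (n + 1) / ρ ^ (n + 1) * |r - s| := by
  have hM : 0 ≤ M := (norm_nonneg _).trans (h0 0)
  have key := Convex.norm_image_sub_le_of_norm_hasDerivWithin_le (s := Ici ρ)
    (f := fun u : ℝ => (u ^ n)⁻¹ • φ (Real.log u / a))
    (f' := fun u : ℝ => (u ^ n)⁻¹ • ((u⁻¹ / a) • deriv φ (Real.log u / a)) +
      (-(n * u ^ (n - 1)) / (u ^ n) ^ 2) • φ (Real.log u / a))
    (C := M * (n + 1) / ρ ^ (n + 1)) ?_ ?_ (convex_Ici ρ) (mem_Ici.2 hs) (mem_Ici.2 hr)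
  · have h : ∀ u : ℝ, φ (Real.log u / a) / ((u ^ n : ℝ) : ℂ) = (u ^ n)⁻¹ • φ (Real.log u / a) := by
      intro u
      rw [Complex.real_smul, Complex.ofReal_inv, div_eq_inv_mul]
    rw [h, h]
    exact key
  · intro u hu
    have hu0 : 0 < u := hρ.trans_le hu
    have e1 : HasDerivAt (fun u : ℝ => (u ^ n)⁻¹) (-(n * u ^ (n - 1)) / (u ^ n) ^ 2) u :=
      (hasDerivAt_pow n u).fun_inv (by positivity)
    have e2 : HasDerivAt (fun u : ℝ => φ (Real.log u / a))
        ((u⁻¹ / a) • deriv φ (Real.log u / a)) u :=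
      (hd _).hasDerivAt.scomp u ((Real.hasDerivAt_log hu0.ne').div_const a)
    exact (e1.smul e2).hasDerivWithinAt
  · intro u hu
    have hu' : ρ ≤ u := hu
    have hu0 : 0 < u := hρ.trans_le hu
    have b1 : ‖(u ^ n)⁻¹ • ((u⁻¹ / a) • deriv φ (Real.log u / a))‖ ≤ M / u ^ (n + 1) := by
      rw [norm_smul, norm_smul, Real.norm_of_nonneg (by positivity),
        Real.norm_of_nonneg (by positivity)]
      calc _ ≤ (u ^ n)⁻¹ * (u⁻¹ / 1 * M) := by
            gcongr
            exact h1 _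
        _ = _ := by rw [pow_succ]; field_simp
    have b2 : ‖(-(n * u ^ (n - 1)) / (u ^ n) ^ 2) • φ (Real.log u / a)‖ ≤
        n * M / u ^ (n + 1) := by
      rw [norm_smul, norm_div, norm_neg, Real.norm_of_nonneg (by positivity),
        Real.norm_of_nonneg (by positivity)]
      rcases Nat.eq_zero_or_pos n with rfl | hn
      · simp
      · have : (u ^ n) ^ 2 = u ^ (n - 1) * u ^ (n + 1) := by
          rw [← pow_mul, ← pow_add]
          congr 1
          omega
        calc _ ≤ n * u ^ (n - 1) / (u ^ n) ^ 2 * M := by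
              gcongr
              exact h0 _
          _ = _ := by rw [this]; field_simp
    calc _ ≤ M / u ^ (n + 1) + n * M / u ^ (n + 1) := (norm_add_le _ _).trans (add_le_add b1 b2)
      _ = M * (n + 1) / u ^ (n + 1) := by ring
      _ ≤ _ := by gcongr

/-- The integrable weight `(1 + |η|)^{-d-1}` on `ℝ^d`. -/
noncomputable def decayWeight {d : ℕ} (η : RealSpace d) : ℝ := ((1 + ‖η‖) ^ (d + 1))⁻¹

theorem integrable_decayWeight (d : ℕ) : Integrable (decayWeight (d := d)) := by
  have h := integrable_one_add_norm (E := RealSpace d) (μ := volume) (r := (d + 1 : ℕ))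
    (by rw [finrank_euclideanSpace_fin]; push_cast; linarith)
  refine h.congr (Eventually.of_forall fun η => ?_)
  simp only [decayWeight]
  rw [Real.rpow_neg (by positivity), Real.rpow_natCast]

theorem decayWeight_nonneg {d : ℕ} (η : RealSpace d) : 0 ≤ decayWeight η := by
  unfold decayWeight
  positivity

theorem integral_decayWeight_scaled (d : ℕ) {R : ℝ} (hR : 0 < R) :
    ∫ ξ : RealSpace d, (R ^ d)⁻¹ * decayWeight (R⁻¹ • ξ) = ∫ η : RealSpace d, decayWeight η := by
  rw [integral_const_mul, Measure.integral_comp_inv_smul_of_nonneg _ _ hR.le,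
    finrank_euclideanSpace_fin, smul_eq_mul, ← mul_assoc, inv_mul_cancel₀ (by positivity), one_mul]

/-- The high frequency part of a symbol has a scale invariant `L¹` modulus of continuity. -/
theorem norm_high_concentrationSymbol_sub_le {N : ℕ} {φ : ℝ → ℂ} {M : ℝ}
    (hd : Differentiable ℝ φ) (h0 : ∀ t, ‖φ t‖ ≤ M) (h1 : ∀ t, ‖deriv φ t‖ ≤ M) {a : ℝ}
    (ha : 1 ≤ a) {R : ℝ} (hR : 1 ≤ R) {h : RealSpace (2 * N)} (hh : 2 * ‖h‖ ≤ R)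
    (ξ : RealSpace (2 * N)) :
    ‖{ξ | R < ‖ξ‖}.indicator (concentrationSymbol N a φ) ξ -
        {ξ | R < ‖ξ‖}.indicator (concentrationSymbol N a φ) (ξ - h)‖ ≤
      M * ((2 * N + 1) * 4 ^ (2 * N + 1)) *
        ((R ^ (2 * N))⁻¹ * decayWeight (R⁻¹ • ξ)) := by
  have hM : 0 ≤ M := (norm_nonneg _).trans (h0 0)
  have hR0 : 0 < R := by linarith
  have hval : ∀ ζ : RealSpace (2 * N), R < ‖ζ‖ →
      {ξ | R < ‖ξ‖}.indicator (concentrationSymbol N a φ) ζ =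
        φ (Real.log ‖ζ‖ / a) / ((‖ζ‖ ^ (2 * N) : ℝ) : ℂ) := by
    intro ζ hζ
    have : 1 ≤ ‖ζ‖ := by linarith
    simp [indicator, hζ, concentrationSymbol, this]
  have hval0 : ∀ ζ : RealSpace (2 * N), ¬ R < ‖ζ‖ →
      {ξ | R < ‖ξ‖}.indicator (concentrationSymbol N a φ) ζ = 0 := by
    intro ζ hζ
    simp [indicator, hζ]
  have hbd : ∀ ζ : RealSpace (2 * N), R < ‖ζ‖ →
      ‖φ (Real.log ‖ζ‖ / a) / ((‖ζ‖ ^ (2 * N) : ℝ) : ℂ)‖ ≤ M * (R ^ (2 * N))⁻¹ := by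
    intro ζ hζ
    rw [norm_div, Complex.norm_real, norm_pow, norm_norm, div_eq_mul_inv]
    gcongr
    exact h0 _
  have hw : decayWeight (R⁻¹ • ξ) = R ^ (2 * N + 1) / (R + ‖ξ‖) ^ (2 * N + 1) := by
    rw [decayWeight, norm_smul, norm_inv, Real.norm_of_nonneg hR0.le, ← inv_pow, ← div_pow]
    congr 1
    field_simp
  have hnn : 0 ≤ M * (R ^ (2 * N))⁻¹ := by positivity
  -- The shell where only one of the two terms survives lies in a ball of radius comparable to `R`.
  have hshell : ‖ξ‖ ≤ 3 * R → M * (R ^ (2 * N))⁻¹ ≤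
      M * ((2 * N + 1) * 4 ^ (2 * N + 1)) * ((R ^ (2 * N))⁻¹ * decayWeight (R⁻¹ • ξ)) := by
    intro hξ
    have h2 : 1 ≤ 4 ^ (2 * N + 1) * decayWeight (R⁻¹ • ξ) := by
      rw [hw, ← div_pow, ← mul_pow]
      refine one_le_pow₀ ?_
      rw [← mul_div_assoc, one_le_div (by positivity)]
      linarith
    have h3 : (1 : ℝ) ≤ 2 * N + 1 := by
      have : (0 : ℝ) ≤ N := by positivity
      linarith
    calc M * (R ^ (2 * N))⁻¹ = M * (R ^ (2 * N))⁻¹ * (1 * 1) := by ring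
      _ ≤ M * (R ^ (2 * N))⁻¹ * ((2 * N + 1) * (4 ^ (2 * N + 1) * decayWeight (R⁻¹ • ξ))) := by
          gcongr
      _ = _ := by ring
  have hn1 : ‖ξ‖ ≤ ‖ξ - h‖ + ‖h‖ := by
    simpa using norm_add_le (ξ - h) h
  by_cases hA : R < ‖ξ‖
  · by_cases hB : R < ‖ξ - h‖
    · rw [hval _ hA, hval _ hB]
      have hρ : 0 < ‖ξ‖ / 2 := by linarith
      refine (norm_radialAmplitude_sub_le hd h0 h1 ha (2 * N) hρ (by linarith)
        (by linarith)).trans ?_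
      have h4 : |‖ξ‖ - ‖ξ - h‖| ≤ R / 2 := by
        have := abs_norm_sub_norm_le ξ (ξ - h)
        rw [sub_sub_cancel] at this
        linarith
      have h5 : R + ‖ξ‖ ≤ 4 * (‖ξ‖ / 2) := by linarith
      calc _ ≤ M * ((2 * N : ℕ) + 1) / (‖ξ‖ / 2) ^ (2 * N + 1) * R := by
            gcongr
            linarith
        _ = M * (2 * N + 1) * 4 ^ (2 * N + 1) * R / (4 * (‖ξ‖ / 2)) ^ (2 * N + 1) := by
            rw [mul_pow]
            push_cast
            field_simp
        _ ≤ M * (2 * N + 1) * 4 ^ (2 * N + 1) * R / (R + ‖ξ‖) ^ (2 * N + 1) := by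
            gcongr
        _ = _ := by
            rw [hw, pow_succ R]
            field_simp
    · rw [hval _ hA, hval0 _ hB, sub_zero]
      exact (hbd _ hA).trans (hshell (by linarith))
  · by_cases hB : R < ‖ξ - h‖
    · rw [hval0 _ hA, hval _ hB, zero_sub, norm_neg]
      exact (hbd _ hB).trans (hshell (by linarith))
    · rw [hval0 _ hA, hval0 _ hB, sub_zero, norm_zero]
      have := decayWeight_nonneg (R⁻¹ • ξ)
      positivity

/-- The frequencies above `2π / |x|` contribute a bounded amount to the oscillatory integral. The
translation is by `π x / |x|²`, half a wavelength, which is at most `R / 2`. -/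
theorem norm_integral_high_le {N : ℕ} {φ : ℝ → ℂ} {M : ℝ}
    (hd : Differentiable ℝ φ) (h0 : ∀ t, ‖φ t‖ ≤ M) (h1 : ∀ t, ‖deriv φ t‖ ≤ M) {a : ℝ}
    (ha : 1 ≤ a) (hi : Integrable (concentrationSymbol N a φ)) {R : ℝ} (hR : 1 ≤ R)
    {x : RealSpace (2 * N)} (hx : x ≠ 0) (hxR : 2 * Real.pi / ‖x‖ ≤ R) :
    ‖∫ ξ, Complex.exp (Complex.I * (inner ℝ x ξ : ℝ)) *
        {ξ | R < ‖ξ‖}.indicator (concentrationSymbol N a φ) ξ‖ ≤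
      M * ((2 * N + 1) * 4 ^ (2 * N + 1)) * ∫ η : RealSpace (2 * N), decayWeight η := by
  have hR0 : 0 < R := by linarith
  have hx0 : 0 < ‖x‖ := norm_pos_iff.2 hx
  set h : RealSpace (2 * N) := (Real.pi / ‖x‖ ^ 2) • x with hh
  have hxh : inner ℝ x h = Real.pi := by
    rw [hh, real_inner_smul_right, real_inner_self_eq_norm_sq]
    field_simp
  have hnh : 2 * ‖h‖ ≤ R := by
    rw [hh, norm_smul, Real.norm_of_nonneg (by positivity)]
    refine le_trans (le_of_eq ?_) hxR
    field_simp
  have hF := hi.indicator (s := {ξ : RealSpace (2 * N) | R < ‖ξ‖})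
    (measurableSet_lt measurable_const measurable_norm)
  refine (norm_integral_exp_inner_mul_le hF hxh).trans ?_
  rw [← integral_decayWeight_scaled (2 * N) hR0, ← integral_const_mul]
  refine integral_mono (hF.sub (hF.comp_sub_right h)).norm ?_ fun ξ =>
    norm_high_concentrationSymbol_sub_le hd h0 h1 ha hR hnh ξ
  exact (((integrable_decayWeight (2 * N)).comp_smul (inv_ne_zero hR0.ne')).const_mul _).const_mul _

/-! ### Smooth profiles: the low frequencies -/

/-- The integral of the symbol over a ball, without the oscillating factor, is a primitive of the
profile. -/
theorem integral_low_concentrationSymbol {N : ℕ} (hN : 1 ≤ N) {a : ℝ} (ha : 0 < a) {φ : ℝ → ℂ}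
    (hφ : IsProfile φ) {R : ℝ} (hR : 0 < R) :
    ∫ ξ, {ξ | ‖ξ‖ ≤ R}.indicator (concentrationSymbol N a φ) ξ =
      ((sphereArea N * a : ℝ) : ℂ) * profilePrimitive φ (Real.log R / a) := by
  have hpos := mul_pos (sphereArea_pos N) ha
  have hm : Measurable fun ξ : RealSpace (2 * N) => Real.log ‖ξ‖ / a := by fun_prop
  set h : ℝ → ℂ := (Iic (Real.log R / a)).indicator φ
  have hh : AEStronglyMeasurable h (volume.restrict (Ioi 0)) := hφ.1.indicator measurableSet_Iic
  have hmap := map_log_norm_dilationMeasure hN ha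
  have e1 : ∫ ξ, h (Real.log ‖ξ‖ / a) ∂dilationMeasure N =
      ((sphereArea N * a : ℝ) : ℂ) * profilePrimitive φ (Real.log R / a) := by
    rw [← integral_map (f := h) hm.aemeasurable (by rw [hmap]; exact hh.smul_measure _), hmap,
      integral_smul_measure, integral_indicator measurableSet_Iic,
      Measure.restrict_restrict measurableSet_Iic, inter_comm, Ioi_inter_Iic,
      ENNReal.toReal_ofReal hpos.le, Complex.real_smul, profilePrimitive]
  rw [← e1, dilationMeasure, integral_withDensity_eq_integral_toReal_smul (by fun_prop)
    (Eventually.of_forall fun _ => ENNReal.ofReal_lt_top),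
    ← integral_indicator (measurableSet_one_le_norm _)]
  refine integral_congr_ae (Eventually.of_forall fun ξ => ?_)
  by_cases h1 : 1 ≤ ‖ξ‖
  · have h0 : 0 < ‖ξ‖ := by linarith
    have hiff : Real.log ‖ξ‖ / a ≤ Real.log R / a ↔ ‖ξ‖ ≤ R := by
      rw [div_le_div_iff_of_pos_right ha, Real.log_le_log_iff h0 hR]
    by_cases h2 : ‖ξ‖ ≤ R
    · simp only [indicator, mem_ofPred_eq, h1, h2, if_true, concentrationSymbol, mem_Iic, hiff, h]
      rw [ENNReal.toReal_ofReal (by positivity), Complex.real_smul, Complex.ofReal_inv,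
        div_eq_inv_mul]
    · simp [indicator, h2, hiff, h]
  · simp [indicator, h1, concentrationSymbol]

theorem integrable_concentrationSymbol {N : ℕ} (hN : 1 ≤ N) {a : ℝ} (ha : 0 < a) {φ : ℝ → ℂ}
    (hφ : IsProfile φ) (hi : IntegrableOn φ (Ioi 0)) : Integrable (concentrationSymbol N a φ) := by
  refine ⟨(memLp_concentrationSymbol hN ha hφ).1, ?_⟩
  have h1 := lintegral_log_norm_dilationMeasure hN ha hφ.1.enorm
  rw [lintegral_dilationMeasure, ← lintegral_indicator (measurableSet_one_le_norm _)] at h1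
  have h2 : ∫⁻ ξ, ‖concentrationSymbol N a φ ξ‖ₑ =
      ENNReal.ofReal (sphereArea N * a) * ∫⁻ t in Ioi (0 : ℝ), ‖φ t‖ₑ := by
    rw [← h1]
    refine lintegral_congr fun ξ => ?_
    by_cases h : 1 ≤ ‖ξ‖
    · simp only [indicator, mem_ofPred_eq, h, if_true, concentrationSymbol]
      rw [← ofReal_norm, norm_div, div_eq_inv_mul, ENNReal.ofReal_mul (by positivity), ofReal_norm,
        Complex.norm_real, norm_pow, norm_norm]
    · simp [indicator, h, concentrationSymbol]
  rw [hasFiniteIntegral_iff_enorm, h2]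
  exact ENNReal.mul_lt_top ENNReal.ofReal_lt_top hi.2

/-- The first moment of the low frequencies. The bound vanishes for `R = 1`, where the domain
degenerates to the unit sphere. -/
theorem lintegral_norm_mul_low_le {N : ℕ} (hN : 1 ≤ N) {φ : ℝ → ℂ} {M : ℝ}
    (h0 : ∀ t, ‖φ t‖ ≤ M) (a : ℝ) {R : ℝ} :
    ∫⁻ ξ, ENNReal.ofReal ‖ξ‖ * ‖{ξ | ‖ξ‖ ≤ R}.indicator (concentrationSymbol N a φ) ξ‖ₑ ≤
      ENNReal.ofReal (sphereArea N * (M * (R - 1))) := by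
  have hM : 0 ≤ M := (norm_nonneg _).trans (h0 0)
  calc _ ≤ ∫⁻ ξ : RealSpace (2 * N), (Icc 1 R).indicator
          (fun r => ENNReal.ofReal (M * (r * (r ^ (2 * N))⁻¹))) ‖ξ‖ := by
        refine lintegral_mono fun ξ => ?_
        by_cases h1 : 1 ≤ ‖ξ‖
        · by_cases h2 : ‖ξ‖ ≤ R
          · simp only [indicator, mem_ofPred_eq, h1, h2, if_true, concentrationSymbol, mem_Icc,
              and_self]
            rw [← ofReal_norm, ← ENNReal.ofReal_mul (norm_nonneg _)]
            refine ENNReal.ofReal_le_ofReal ?_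
            rw [norm_div, Complex.norm_real, norm_pow, norm_norm, div_eq_mul_inv]
            calc _ ≤ ‖ξ‖ * (M * (‖ξ‖ ^ (2 * N))⁻¹) := by
                  gcongr
                  exact h0 _
              _ = _ := by ring
          · simp [indicator, h2]
        · simp [indicator, h1, concentrationSymbol]
    _ ≤ ENNReal.ofReal (sphereArea N) * ∫⁻ r in Ioi (0 : ℝ),
          (Icc 1 R).indicator (fun _ => ENNReal.ofReal M) r := by
        rw [lintegral_fun_norm_eq hN (Measurable.indicator (by fun_prop) measurableSet_Icc)]
        refine mul_le_mul_right (setLIntegral_mono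
          (measurable_const.indicator measurableSet_Icc) fun r hr => ?_) _
        have hr0 : 0 < r := hr
        by_cases h : r ∈ Icc 1 R
        · simp only [indicator, h, if_true]
          rw [← ENNReal.ofReal_mul (by positivity)]
          refine ENNReal.ofReal_le_ofReal (le_of_eq ?_)
          have : r ^ (2 * N) = r ^ (2 * N - 1) * r := by
            rw [← pow_succ, Nat.sub_add_cancel (by omega)]
          rw [this]
          field_simp
        · simp [indicator, h]
    _ ≤ ENNReal.ofReal (sphereArea N) * (ENNReal.ofReal M * ENNReal.ofReal (R - 1)) := by
        refine mul_le_mul_right ?_ _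
        rw [lintegral_indicator_const measurableSet_Icc]
        refine mul_le_mul_right ((Measure.restrict_apply_le _ _).trans ?_) _
        rw [Real.volume_Icc]
    _ = _ := by
        rw [← ENNReal.ofReal_mul hM, ← ENNReal.ofReal_mul (sphereArea_pos N).le]

theorem norm_profilePrimitive_sub_le {φ : ℝ → ℂ} {M : ℝ} (hc : Continuous φ)
    (h0 : ∀ t, ‖φ t‖ ≤ M) (y z : ℝ) :
    ‖profilePrimitive φ y - profilePrimitive φ z‖ ≤ M * |max y 0 - max z 0| := by
  rw [profilePrimitive_eq_intervalIntegral, profilePrimitive_eq_intervalIntegral,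
    intervalIntegral.integral_interval_sub_left (hc.intervalIntegrable _ _)
      (hc.intervalIntegrable _ _)]
  exact intervalIntegral.norm_integral_le_of_norm_le_const fun t _ => h0 t

/-- At the frequency scale `1 / |x|` the phase is essentially constant, so the low frequencies
reproduce the primitive of the profile. -/
theorem norm_integral_low_sub_le {N : ℕ} (hN : 1 ≤ N) {φ : ℝ → ℂ} (hφ : IsProfile φ) {M : ℝ}
    (hc : Continuous φ) (h0 : ∀ t, ‖φ t‖ ≤ M) {a : ℝ} (ha : 0 < a)
    (hi : Integrable (concentrationSymbol N a φ)) {x : RealSpace (2 * N)} (hx : x ≠ 0) :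
    ‖(∫ ξ, Complex.exp (Complex.I * (inner ℝ x ξ : ℝ)) *
        {ξ | ‖ξ‖ ≤ max 1 (2 * Real.pi / ‖x‖)}.indicator (concentrationSymbol N a φ) ξ) -
      ((sphereArea N * a : ℝ) : ℂ) * profilePrimitive φ (-Real.log ‖x‖ / a)‖ ≤
      M * (sphereArea N * (2 * Real.pi + Real.log (2 * Real.pi))) := by
  have hM : 0 ≤ M := (norm_nonneg _).trans (h0 0)
  have hx0 : 0 < ‖x‖ := norm_pos_iff.2 hx
  have hω := sphereArea_pos N
  set R := max 1 (2 * Real.pi / ‖x‖) with hR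
  have hR1 : 1 ≤ R := le_max_left _ _
  set F := {ξ | ‖ξ‖ ≤ R}.indicator (concentrationSymbol N a φ) with hFdef
  have hF : Integrable F := hi.indicator (measurableSet_le measurable_norm measurable_const)
  have heF : Integrable fun ξ => Complex.exp (Complex.I * (inner ℝ x ξ : ℝ)) * F ξ := by
    refine hF.bdd_mul (c := 1) (by fun_prop) (Eventually.of_forall fun ξ => ?_)
    rw [mul_comm, Complex.norm_exp_ofReal_mul_I]
  -- Replacing the phase by `1` costs at most `‖x‖` times the first moment of the low frequencies.
  have e1 : ‖(∫ ξ, Complex.exp (Complex.I * (inner ℝ x ξ : ℝ)) * F ξ) - ∫ ξ, F ξ‖ ≤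
      M * (sphereArea N * (2 * Real.pi)) := by
    rw [← integral_sub heF hF, ← ENNReal.ofReal_le_ofReal_iff (by positivity), ofReal_norm]
    calc _ ≤ ∫⁻ ξ, ENNReal.ofReal ‖x‖ * (ENNReal.ofReal ‖ξ‖ * ‖F ξ‖ₑ) := by
          refine (enorm_integral_le_lintegral_enorm _).trans (lintegral_mono fun ξ => ?_)
          have h1 : Complex.exp (Complex.I * (inner ℝ x ξ : ℝ)) * F ξ - F ξ =
              (Complex.exp (Complex.I * (inner ℝ x ξ : ℝ)) - 1) * F ξ := by ring
          rw [h1, enorm_mul, ← mul_assoc, ← ENNReal.ofReal_mul hx0.le]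
          refine mul_le_mul_left ?_ _
          rw [← ofReal_norm]
          refine ENNReal.ofReal_le_ofReal
            ((Real.norm_exp_I_mul_ofReal_sub_one_le).trans ?_)
          exact norm_inner_le_norm x ξ
      _ ≤ ENNReal.ofReal ‖x‖ * ENNReal.ofReal (sphereArea N * (M * (R - 1))) := by
          rw [lintegral_const_mul' _ _ ENNReal.ofReal_ne_top]
          exact mul_le_mul_right (lintegral_norm_mul_low_le hN h0 a) _
      _ ≤ _ := by
          rw [← ENNReal.ofReal_mul hx0.le]
          refine ENNReal.ofReal_le_ofReal ?_
          have h2 : ‖x‖ * (R - 1) ≤ 2 * Real.pi := by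
            rcases le_total (2 * Real.pi / ‖x‖) 1 with h | h
            · rw [hR, max_eq_left h, sub_self, mul_zero]
              positivity
            · rw [hR, max_eq_right h, mul_sub, mul_div_cancel₀ _ hx0.ne']
              linarith
          calc _ = M * (sphereArea N * (‖x‖ * (R - 1))) := by ring
            _ ≤ _ := by gcongr
  have hlog : 0 ≤ Real.log (2 * Real.pi) :=
    Real.log_nonneg (by linarith [Real.pi_gt_three])
  -- The cut-off `log R` differs from the positive part of `-log ‖x‖` by at most `log (2π)`.
  have e2 : ‖(∫ ξ, F ξ) -
      ((sphereArea N * a : ℝ) : ℂ) * profilePrimitive φ (-Real.log ‖x‖ / a)‖ ≤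
      M * (sphereArea N * Real.log (2 * Real.pi)) := by
    rw [hFdef, integral_low_concentrationSymbol hN ha hφ (by linarith), ← mul_sub, norm_mul,
      Complex.norm_real, Real.norm_of_nonneg (by positivity)]
    have h1 : Real.log R = max 0 (Real.log (2 * Real.pi) - Real.log ‖x‖) := by
      rw [← Real.log_div (by positivity) hx0.ne', hR]
      rcases le_total (2 * Real.pi / ‖x‖) 1 with h | h
      · rw [max_eq_left h, Real.log_one, max_eq_left (Real.log_nonpos (by positivity) h)]
      · rw [max_eq_right h, max_eq_right (Real.log_nonneg h)]
    have h2 : |max (Real.log R / a) 0 - max (-Real.log ‖x‖ / a) 0| ≤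
        Real.log (2 * Real.pi) / a := by
      have h3 : ∀ y : ℝ, max (y / a) 0 = max y 0 / a := fun y => by
        rw [max_div_div_right ha.le y 0 |>.symm, zero_div]
      rw [h3, h3, ← sub_div, abs_div, abs_of_pos ha, h1]
      gcongr
      rw [max_comm 0, max_assoc, max_self]
      refine (abs_max_sub_max_le_abs _ _ _).trans (le_of_eq ?_)
      rw [sub_neg_eq_add, sub_add_cancel, abs_of_nonneg hlog]
    calc _ ≤ sphereArea N * a * (M * (Real.log (2 * Real.pi) / a)) := by
          gcongr
          exact (norm_profilePrimitive_sub_le hc h0 _ _).trans (by gcongr)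
      _ = _ := by field_simp
  calc _ ≤ M * (sphereArea N * (2 * Real.pi)) + M * (sphereArea N * Real.log (2 * Real.pi)) :=
        (norm_sub_le_norm_sub_add_norm_sub _ _ _).trans (add_le_add e1 e2)
    _ = _ := by ring

/-! ### Smooth profiles: convergence of the error -/

theorem lintegral_concentrationSymbol_sq_le {N : ℕ} (hN : 1 ≤ N) {φ : ℝ → ℂ} {M : ℝ}
    (h0 : ∀ t, ‖φ t‖ ≤ M) (a : ℝ) :
    ∫⁻ ξ, ‖concentrationSymbol N a φ ξ‖ₑ ^ 2 ≤
      ENNReal.ofReal (M ^ 2 * 2 ^ (2 * N + 1) * ∫ η : RealSpace (2 * N), decayWeight η) := by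
  have hM : 0 ≤ M := (norm_nonneg _).trans (h0 0)
  rw [← integral_const_mul, ofReal_integral_eq_lintegral_ofReal
    ((integrable_decayWeight _).const_mul _)
    (Eventually.of_forall fun η => mul_nonneg (by positivity) (decayWeight_nonneg η))]
  refine lintegral_mono fun ξ => ?_
  by_cases h : 1 ≤ ‖ξ‖
  · have h0' : 0 < ‖ξ‖ := by linarith
    simp only [concentrationSymbol, indicator, mem_ofPred_eq, h, if_true]
    rw [← ofReal_norm, ← ENNReal.ofReal_pow (norm_nonneg _)]
    refine ENNReal.ofReal_le_ofReal ?_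
    rw [norm_div, Complex.norm_real, norm_pow, norm_norm, div_pow, ← pow_mul, decayWeight]
    have h2 : (1 + ‖ξ‖) ^ (2 * N + 1) ≤ 2 ^ (2 * N + 1) * ‖ξ‖ ^ (2 * N * 2) := by
      calc (1 + ‖ξ‖) ^ (2 * N + 1) ≤ (2 * ‖ξ‖) ^ (2 * N + 1) := by gcongr; linarith
        _ = 2 ^ (2 * N + 1) * ‖ξ‖ ^ (2 * N + 1) := mul_pow _ _ _
        _ ≤ _ := by
            gcongr
            omega
    calc _ ≤ M ^ 2 / ‖ξ‖ ^ (2 * N * 2) := by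
          gcongr
          exact h0 _
      _ ≤ M ^ 2 * 2 ^ (2 * N + 1) / (1 + ‖ξ‖) ^ (2 * N + 1) := by
          rw [div_le_div_iff₀ (by positivity) (by positivity), mul_assoc]
          gcongr
      _ = _ := div_eq_mul_inv _ _
  · simp [concentrationSymbol, h]

theorem profilePrimitive_of_nonpos (φ : ℝ → ℂ) {y : ℝ} (hy : y ≤ 0) :
    profilePrimitive φ y = 0 := by
  rw [profilePrimitive, Ioc_eq_empty (not_lt.2 hy), setIntegral_empty]

theorem moserConcentration_of_one_le_norm {N : ℕ} {a : ℝ} (ha : 0 < a) (φ : ℝ → ℂ)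
    {x : RealSpace (2 * N)} (hx : 1 ≤ ‖x‖) : moserConcentration N a φ x = 0 := by
  rw [moserConcentration, profilePrimitive_of_nonpos, mul_zero]
  exact div_nonpos_of_nonpos_of_nonneg (by linarith [Real.log_nonneg hx]) ha.le

/-- For smooth profiles the error is `O(1 / √a)` uniformly in space. -/
theorem exists_norm_elementaryConcentration_sub_le {N : ℕ} (hN : 1 ≤ N) :
    ∃ K : ℝ, 0 ≤ K ∧ ∀ {a : ℝ} (ha : 0 < a) {φ : ℝ → ℂ} (hφ : IsProfile φ) {M : ℝ}, 1 ≤ a →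
      IntegrableOn φ (Ioi 0) → Differentiable ℝ φ → (∀ t, ‖φ t‖ ≤ M) →
      (∀ t, ‖deriv φ t‖ ≤ M) →
      ∀ᵐ x, ‖elementaryConcentration hN ha hφ x - moserConcentration N a φ x‖ ≤ K * M / √a := by
  have : Nonempty (Fin (2 * N)) := ⟨⟨0, by omega⟩⟩
  have hω := sphereArea_pos N
  have hC := concentrationConst_pos N
  have hJ : 0 ≤ ∫ η : RealSpace (2 * N), decayWeight η := integral_nonneg decayWeight_nonneg
  have hlog : 0 ≤ Real.log (2 * Real.pi) :=
    Real.log_nonneg (by linarith [Real.pi_gt_three])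
  refine ⟨concentrationConst N * (sphereArea N * (2 * Real.pi + Real.log (2 * Real.pi)) +
    (2 * N + 1) * 4 ^ (2 * N + 1) * ∫ η : RealSpace (2 * N), decayWeight η), by positivity, ?_⟩
  intro a ha φ hφ M ha1 hi hd h0 h1
  have hsi := integrable_concentrationSymbol hN ha hφ hi
  have hsa : 0 < √a := Real.sqrt_pos.2 ha
  have hne : ∀ᵐ x : RealSpace (2 * N), x ≠ 0 := Measure.ae_ne volume 0
  filter_upwards [plancherelIntegral_ae_eq (memLp_concentrationSymbol hN ha hφ) hsi, hne]
    with x hx hx0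
  set R := max 1 (2 * Real.pi / ‖x‖)
  have hlow := norm_integral_low_sub_le hN hφ hd.continuous h0 ha hsi hx0
  have hhigh := norm_integral_high_le hd h0 h1 ha1 hsi (le_max_left 1 (2 * Real.pi / ‖x‖)) hx0
    (le_max_right _ _)
  have hint : ∀ {F : RealSpace (2 * N) → ℂ}, Integrable F →
      Integrable fun ξ => Complex.exp (Complex.I * (inner ℝ x ξ : ℝ)) * F ξ := by
    refine fun hF => hF.bdd_mul (c := 1) (by fun_prop) (Eventually.of_forall fun ξ => ?_)
    rw [mul_comm, Complex.norm_exp_ofReal_mul_I]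
  have hcompl : {ξ : RealSpace (2 * N) | R < ‖ξ‖} = {ξ | ‖ξ‖ ≤ R}ᶜ := by
    ext ξ; simp
  have hmeas : MeasurableSet {ξ : RealSpace (2 * N) | ‖ξ‖ ≤ R} :=
    measurableSet_le measurable_norm measurable_const
  have hsum : ∫ ξ, Complex.exp (Complex.I * (inner ℝ x ξ : ℝ)) * concentrationSymbol N a φ ξ =
      (∫ ξ, Complex.exp (Complex.I * (inner ℝ x ξ : ℝ)) *
        {ξ | ‖ξ‖ ≤ R}.indicator (concentrationSymbol N a φ) ξ) +
      ∫ ξ, Complex.exp (Complex.I * (inner ℝ x ξ : ℝ)) *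
        {ξ | R < ‖ξ‖}.indicator (concentrationSymbol N a φ) ξ := by
    rw [hcompl, ← integral_add (hint (hsi.indicator hmeas)) (hint (hsi.indicator hmeas.compl))]
    refine integral_congr_ae (Eventually.of_forall fun ξ => ?_)
    simp only
    rw [← mul_add, ← Pi.add_apply, indicator_self_add_compl]
  -- This is where the constants `C_N ω_{2N-1} = C̃_N` have to match exactly.
  have hmoser : moserConcentration N a φ x = ((concentrationConst N / √a : ℝ) : ℂ) *
      (((sphereArea N * a : ℝ) : ℂ) * profilePrimitive φ (-Real.log ‖x‖ / a)) := by
    rw [moserConcentration, ← concentrationConst_mul_sphereArea, ← mul_assoc,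
      ← Complex.ofReal_mul]
    congr 2
    rw [div_mul_eq_mul_div, eq_div_iff hsa.ne']
    rw [mul_assoc, Real.mul_self_sqrt ha.le]
    ring
  rw [elementaryConcentration, hx, hsum, hmoser, ← mul_sub, norm_mul, Complex.norm_real,
    Real.norm_of_nonneg (by positivity), add_sub_right_comm]
  calc _ ≤ concentrationConst N / √a * (M * (sphereArea N *
          (2 * Real.pi + Real.log (2 * Real.pi))) +
          M * ((2 * N + 1) * 4 ^ (2 * N + 1)) * ∫ η : RealSpace (2 * N), decayWeight η) := by
        gcongr
        exact (norm_add_le _ _).trans (add_le_add hlow hhigh)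
    _ = _ := by ring

/-- For smooth profiles the error is `O(1 / √a)` in `L²`. -/
theorem exists_lintegral_elementaryConcentration_sub_sq_le {N : ℕ} (hN : 1 ≤ N) :
    ∃ K : ℝ, 0 ≤ K ∧ ∀ {a : ℝ} (ha : 0 < a) {φ : ℝ → ℂ} (hφ : IsProfile φ) {M : ℝ}, 1 ≤ a →
      IntegrableOn φ (Ioi 0) → Differentiable ℝ φ → (∀ t, ‖φ t‖ ≤ M) →
      (∀ t, ‖deriv φ t‖ ≤ M) →
      ∫⁻ x, ‖(elementaryConcentration hN ha hφ - moserConcentration N a φ) x‖ₑ ^ 2 ≤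
        ENNReal.ofReal (K * M ^ 2 / a) := by
  obtain ⟨K, hK, hKbd⟩ := exists_norm_elementaryConcentration_sub_le hN
  have hC := concentrationConst_pos N
  have hJ : 0 ≤ ∫ η : RealSpace (2 * N), decayWeight η := integral_nonneg decayWeight_nonneg
  set V := (volume (Metric.ball (0 : RealSpace (2 * N)) 1)).toReal with hV
  have hV0 : 0 ≤ V := ENNReal.toReal_nonneg
  refine ⟨K ^ 2 * V + concentrationConst N ^ 2 * ((2 * Real.pi) ^ (2 * N) *
    (2 ^ (2 * N + 1) * ∫ η : RealSpace (2 * N), decayWeight η)), by positivity, ?_⟩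
  intro a ha φ hφ M ha1 hi hd h0 h1
  have hM : 0 ≤ M := (norm_nonneg _).trans (h0 0)
  have hsa : 0 < √a := Real.sqrt_pos.2 ha
  have hsup := hKbd ha hφ ha1 hi hd h0 h1
  set g := elementaryConcentration hN ha hφ with hg
  have e1 : ∫⁻ x in Metric.ball 0 1, ‖(g - moserConcentration N a φ) x‖ₑ ^ 2 ≤
      ENNReal.ofReal ((K * M / √a) ^ 2 * V) := by
    rw [ENNReal.ofReal_mul (by positivity), hV, ENNReal.ofReal_toReal measure_ball_lt_top.ne,
      ← setLIntegral_const]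
    refine lintegral_mono_ae (ae_restrict_of_ae ?_)
    filter_upwards [hsup] with x hx
    rw [← ofReal_norm, ← ENNReal.ofReal_pow (norm_nonneg _)]
    refine ENNReal.ofReal_le_ofReal ?_
    rw [Pi.sub_apply]
    gcongr
  -- Outside the unit ball the Moser function vanishes and Plancherel's identity applies.
  have e2 : ∫⁻ x in (Metric.ball 0 1)ᶜ, ‖(g - moserConcentration N a φ) x‖ₑ ^ 2 ≤
      ENNReal.ofReal ((concentrationConst N / √a) ^ 2 * ((2 * Real.pi) ^ (2 * N) *
        (M ^ 2 * 2 ^ (2 * N + 1) * ∫ η : RealSpace (2 * N), decayWeight η))) := by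
    calc _ ≤ ∫⁻ x, ‖g x‖ₑ ^ 2 := by
          refine le_trans (le_of_eq (setLIntegral_congr_fun measurableSet_ball.compl
            fun x hx => ?_)) (setLIntegral_le_lintegral _ _)
          have hx1 : 1 ≤ ‖x‖ := by simpa using hx
          simp only [Pi.sub_apply]
          rw [moserConcentration_of_one_le_norm ha φ hx1, sub_zero]
      _ = ENNReal.ofReal ((concentrationConst N / √a) ^ 2) *
          ∫⁻ x, ‖plancherelIntegral (memLp_concentrationSymbol hN ha hφ) x‖ₑ ^ 2 := by
          rw [← lintegral_const_mul' _ _ ENNReal.ofReal_ne_top]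
          refine lintegral_congr fun x => ?_
          rw [hg, elementaryConcentration, enorm_mul, mul_pow,
            ← ofReal_norm ((concentrationConst N / √a : ℝ) : ℂ), Complex.norm_real,
            Real.norm_of_nonneg (by positivity), ENNReal.ofReal_pow (by positivity)]
      _ ≤ _ := by
          rw [lintegral_enorm_sq_plancherelIntegral, ENNReal.ofReal_mul (by positivity),
            ENNReal.ofReal_mul (by positivity)]
          gcongr
          exact lintegral_concentrationSymbol_sq_le hN h0 a
  rw [← lintegral_add_compl _ (measurableSet_ball (x := (0 : RealSpace (2 * N))) (ε := 1))]
  refine (add_le_add e1 e2).trans (le_of_eq ?_)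
  rw [← ENNReal.ofReal_add (by positivity) (by positivity)]
  congr 1
  rw [div_pow, div_pow, Real.sq_sqrt ha.le]
  ring

theorem tendsto_orliczModular_of_smooth {N : ℕ} (hN : 1 ≤ N) {α : ℕ → ℝ} (hα : IsScale α)
    {φ : ℝ → ℂ} (hφ : IsProfile φ) (hs : HasCompactSupport φ) (hd : ContDiff ℝ 1 φ) {c : ℝ}
    (hc : 0 < c) :
    Tendsto (fun n => orliczModular expSqSubOne
      (elementaryConcentration hN (hα.pos n) hφ - moserConcentration N (α n) φ) c)
      atTop (𝓝 0) := by
  obtain ⟨K, hK, hKbd⟩ := exists_norm_elementaryConcentration_sub_le hN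
  obtain ⟨L, hL, hLbd⟩ := exists_lintegral_elementaryConcentration_sub_sq_le hN
  obtain ⟨M₀, hM₀⟩ := hd.continuous.bounded_above_of_compact_support hs
  obtain ⟨M₁, hM₁⟩ := (hd.continuous_deriv le_rfl).bounded_above_of_compact_support hs.deriv
  set M := max M₀ M₁
  have h0 : ∀ t, ‖φ t‖ ≤ M := fun t => (hM₀ t).trans (le_max_left _ _)
  have h1 : ∀ t, ‖deriv φ t‖ ≤ M := fun t => (hM₁ t).trans (le_max_right _ _)
  have hM : 0 ≤ M := (norm_nonneg _).trans (h0 0)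
  have hi : IntegrableOn φ (Ioi 0) :=
    (hd.continuous.integrable_of_hasCompactSupport hs).integrableOn
  have hdiff : Differentiable ℝ φ := hd.differentiable one_ne_zero
  have hlim : Tendsto (fun n => ENNReal.ofReal
      (Real.exp ((K * M / c) ^ 2) / c ^ 2 * (L * M ^ 2 / α n))) atTop (𝓝 0) := by
    rw [← ENNReal.ofReal_zero]
    refine ENNReal.tendsto_ofReal ?_
    have := (hα.tendsto_atTop.const_div_atTop (L * M ^ 2)).const_mul
      (Real.exp ((K * M / c) ^ 2) / c ^ 2)
    rwa [mul_zero] at this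
  refine tendsto_of_tendsto_of_tendsto_of_le_of_le' tendsto_const_nhds hlim
    (Eventually.of_forall fun _ => zero_le) ?_
  filter_upwards [hα.tendsto_atTop.eventually_ge_atTop 1] with n hn
  have hb : ∀ᵐ x, ‖(elementaryConcentration hN (hα.pos n) hφ -
      moserConcentration N (α n) φ) x‖ ≤ K * M := by
    filter_upwards [hKbd (hα.pos n) hφ hn hi hdiff h0 h1] with x hx
    exact hx.trans (div_le_self (by positivity) (Real.one_le_sqrt.2 hn))
  refine (orliczModular_le_of_bounded hc hb).trans ?_
  rw [ENNReal.ofReal_mul (by positivity)]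
  gcongr
  exact hLbd (hα.pos n) hφ hn hi hdiff h0 h1

/-! ### Square integrable profiles -/

theorem concentrationSymbol_add (N : ℕ) (a : ℝ) (φ χ : ℝ → ℂ) :
    concentrationSymbol N a (φ + χ) = concentrationSymbol N a φ + concentrationSymbol N a χ := by
  funext ξ
  by_cases h : 1 ≤ ‖ξ‖ <;> simp [concentrationSymbol, h, add_div]

theorem elementaryConcentration_ae_eq_sub_add {N : ℕ} (hN : 1 ≤ N) {a : ℝ} (ha : 0 < a)
    {φ χ : ℝ → ℂ} (hφ : IsProfile φ) (hχ : IsProfile χ) (h : IsProfile (φ - χ)) :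
    elementaryConcentration hN ha hφ =ᵐ[volume]
      elementaryConcentration hN ha h + elementaryConcentration hN ha hχ := by
  have h1 := plancherelIntegral_add (memLp_concentrationSymbol hN ha h)
    (memLp_concentrationSymbol hN ha hχ)
  have h2 := concentrationSymbol_add N a (φ - χ) χ
  rw [sub_add_cancel] at h2
  rw [← plancherelIntegral_congr (memLp_concentrationSymbol hN ha hφ) _
    (Eventually.of_forall (congrFun h2))] at h1
  filter_upwards [h1] with x hx
  simp only [elementaryConcentration, Pi.add_apply, hx, mul_add]

theorem moserConcentration_add (N : ℕ) (a : ℝ) {φ χ : ℝ → ℂ} (hφ : IsProfile φ)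
    (hχ : IsProfile χ) :
    moserConcentration N a (φ + χ) = moserConcentration N a φ + moserConcentration N a χ := by
  funext x
  simp only [moserConcentration, Pi.add_apply, ← mul_add, profilePrimitive]
  rw [integral_add (hφ.integrableOn_Ioc _) (hχ.integrableOn_Ioc _)]

/-- The error term is bounded in the Orlicz space by the `L²` norm of the profile, uniformly in the
scale; this makes the density argument possible. -/
theorem exists_orliczModular_sub_le {N : ℕ} (hN : 1 ≤ N) :
    ∃ K : ℝ, 0 < K ∧ ∀ {a : ℝ} (ha : 0 < a) {φ : ℝ → ℂ} (hφ : IsProfile φ) {A : ℝ}, 0 < A →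
      eLpNorm φ 2 (volume.restrict (Ioi 0)) ≤ ENNReal.ofReal A →
      orliczModular expSqSubOne
        (elementaryConcentration hN ha hφ - moserConcentration N a φ) (K * A) ≤ 1 := by
  obtain ⟨K, hK, hKbd⟩ := exists_orliczModular_elementaryConcentration_le hN
  obtain ⟨L, hL, hLbd⟩ := exists_orliczModular_moserConcentration_le hN
  refine ⟨K + L, by positivity, fun {a} ha {φ} hφ {A} hA h => ?_⟩
  rw [sub_eq_add_neg, add_mul]
  refine orliczModular_add_le_one (aestronglyMeasurable_elementaryConcentration hN ha hφ)
    (by positivity) (by positivity) (hKbd ha hφ hA h) ?_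
  rw [orliczModular_neg]
  exact hLbd ha hφ hA h

theorem mainTheorem2 (N : ℕ) (hN : 1 ≤ N) (α : ℕ → ℝ) (hα : IsScale α) (φ : ℝ → ℂ)
    (hφ : IsProfile φ) :
    ∃ t : ℕ → RealSpace (2 * N) → ℂ,
      (∀ n x, elementaryConcentration hN (hα.pos n) hφ x =
        moserConcentration N (α n) φ x + t n x) ∧
      (∀ n, MemOrlicz expSqSubOne (t n)) ∧
      Tendsto (fun n => orliczNorm expSqSubOne (t n)) atTop (𝓝 0) := by
  obtain ⟨K, hK, hKbd⟩ := exists_orliczModular_sub_le hN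
  refine ⟨fun n => elementaryConcentration hN (hα.pos n) hφ - moserConcentration N (α n) φ,
    fun n x => by simp, fun n => ⟨?_, ?_⟩, ?_⟩
  · exact (aestronglyMeasurable_elementaryConcentration hN _ hφ).sub
      (aestronglyMeasurable_moserConcentration N _ hφ)
  · set A := (eLpNorm φ 2 (volume.restrict (Ioi 0))).toReal + 1 with hA
    have hA0 : 0 < A := by positivity
    have hφA : eLpNorm φ 2 (volume.restrict (Ioi 0)) ≤ ENNReal.ofReal A := by
      rw [← ENNReal.ofReal_toReal hφ.2.ne]
      exact ENNReal.ofReal_le_ofReal (by rw [hA]; linarith)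
    exact ⟨K * A, by positivity, (hKbd (hα.pos n) hφ hA0 hφA).trans_lt ENNReal.one_lt_top⟩
  · refine ENNReal.tendsto_nhds_zero.2 fun ε hε => ?_
    obtain ⟨r, hr0, hrε⟩ := ENNReal.lt_iff_exists_nnreal_btwn.1 hε
    have hr : (0 : ℝ) < r := by exact_mod_cast hr0
    -- The rough part of the profile contributes `K * δ`, the smooth part at most `δ`.
    set δ : ℝ := r / (K + 1) with hδ
    have hδ0 : 0 < δ := by positivity
    obtain ⟨χ, hχs, hχd, hχ⟩ := MemLp.exist_eLpNorm_sub_le (by norm_num) (by norm_num) hφ hδ0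
    have hχp : IsProfile χ := hχd.continuous.memLp_of_hasCompactSupport hχs
    have hsub : IsProfile (φ - χ) := hφ.sub hχp
    have hev := (tendsto_orliczModular_of_smooth hN hα hχp hχs
      (hχd.of_le (by exact_mod_cast le_top)) hδ0).eventually_le_const one_pos
    filter_upwards [hev] with n hn
    have hae : elementaryConcentration hN (hα.pos n) hφ - moserConcentration N (α n) φ
        =ᵐ[volume] (elementaryConcentration hN (hα.pos n) hsub -
            moserConcentration N (α n) (φ - χ)) +
          (elementaryConcentration hN (hα.pos n) hχp - moserConcentration N (α n) χ) := by
      have h1 := elementaryConcentration_ae_eq_sub_add hN (hα.pos n) hφ hχp hsub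
      have h2 := moserConcentration_add N (α n) hsub hχp
      rw [sub_add_cancel] at h2
      filter_upwards [h1] with x hx
      simp only [Pi.sub_apply, Pi.add_apply, hx, h2]
      ring
    have hle := orliczModular_add_le_one
      ((aestronglyMeasurable_elementaryConcentration hN (hα.pos n) hsub).sub
        (aestronglyMeasurable_moserConcentration N (α n) hsub)) (mul_pos hK hδ0) hδ0
      (hKbd (hα.pos n) hsub hδ0 hχ) hn
    rw [← orliczModular_congr_ae hae] at hle
    refine (orliczNorm_le (by positivity) hle).trans (le_trans (le_of_eq ?_) hrε.le)
    rw [← ENNReal.ofReal_coe_nnreal]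
    congr 1
    rw [hδ]
    field_simp
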